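/- Let $0<\alpha<1$, let $f\in C^\infty(\mathbb{R})$ be convex and let $\phi_->\phi_+$ be real numbers. Put \[ c=\frac{f(\phi_+)-f(\phi_-)}{\phi_+-\phi_-},\qquad h(u)=-c(u-\phi_-)+f(u)-f(\phi_-),\qquad \mathcal{D}^\alpha[g](x)=\frac{1}{\Gamma(1-\alpha)}\int_{-\infty}^{x}\frac{g'(z)}{(x-z)^\alpha}\,dz , \] the integral at $-\infty$ being understood as an improper integral. For $\varepsilon>0$ a travelling wave $\phi_\varepsilon$ is a function $\phi_\varepsilon\in C^1(\mathbb{R})$ such that \[ h(\phi_\varepsilon(\xi))=\varepsilon\,\mathcal{D}^\alpha[\phi_\varepsilon](\xi)\quad(\xi\in\mathbb{R}),\qquad \lim_{\xi\to-\infty}\phi_\varepsilon(\xi)=\phi_-,\qquad \lim_{\xi\to+\infty}\phi_\varepsilon(\xi)=\phi_+ . \] Then the following hold. (1) For every $\varepsilon>0$ and every travelling wave $\phi_\varepsilon$ one has $h'(\phi_-)>0$, \[ |\phi_\varepsilon(\xi)-\phi_-|=O\bigl(e^{\lambda_\varepsilon\xi}\bigr)\ (\xi\to-\infty),\qquad \lambda_\varepsilon=\Bigl(\frac{h'(\phi_-)}{\varepsilon}\Bigr)^{1/\alpha}>0,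 \] \[ |\phi_\varepsilon(\xi)-\phi_+|=O\Bigl(\frac{\varepsilon}{\xi^\alpha}\Bigr)\ (\xi\to+\infty), \] and the decay on the right is not faster than that: $\varepsilon/\xi^{\alpha}=O(|\phi_\varepsilon(\xi)-\phi_+|)$ as $\xi\to+\infty$. (2) The upper bounds are uniform in $\varepsilon$ once the translation is fixed: for every $m\in(\phi_+,\phi_-)$ there is a constant $C>0$ such that for every $\varepsilon>0$, every travelling wave $\phi_\varepsilon$ and every $\xi_0$ with $\phi_\varepsilon(\xi_0)=m$, \[ |\phi_\varepsilon(\xi)-\phi_-|\le C e^{\lambda_\varepsilon(\xi-\xi_0)}\ (\xi<\xi_0),\qquad |\phi_\varepsilon(\xi)-\phi_+|\le \frac{C\,\varepsilon}{(\xi-\xi_0)^\alpha}\ (\xi>\xi_0). \] (3) Let $(\phi_\varepsilon)_{\varepsilon>0}$ be a family of travelling waves, and suppose that for some $m\in(\phi_+,\phi_-)$ there are points $\xi_\varepsilon$ with $\phi_\varepsilon(\xi_\varepsilon)=m$ and $\xi_\varepsilon\to\xi_0$ as $\varepsilon\to0^+$ (for example $\phi_\varepsilon(\xi_0)=m$ for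 all $\varepsilon$). Then, as $\varepsilon\to0^+$, $\phi_\varepsilon(\xi)\to\phi_-$ for every $\xi<\xi_0$ and $\phi_\varepsilon(\xi)\to\phi_+$ for every $\xi>\xi_0$. -/

import Mathlib

open Filter Topology Asymptotics
open scoped ContDiff

noncomputable section

namespace FracTW

/-- `HasFracDeriv α g x v` says that the integral from `-∞` defining the fractional derivative
`𝒟^α[g](x) = 1 / Γ(1 - α) * ∫_{-∞}^x g'(z) / (x - z)^α dz` converges and has the value `v`.
The integral at `-∞` is an improper one; absolutely convergent integrals are a special case. -/
def HasFracDeriv (α : ℝ) (g : ℝ → ℝ) (x v : ℝ) : Prop :=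
  Tendsto (fun a : ℝ => 1 / Real.Gamma (1 - α) * ∫ z in a..x, deriv g z / (x - z) ^ α)
    atBot (𝓝 v)

/-- The wave speed given by the Rankine-Hugoniot condition. -/
def speed (f : ℝ → ℝ) (φm φp : ℝ) : ℝ := (f φp - f φm) / (φp - φm)

/-- `h(u) = -c (u - φ₋) + f(u) - f(φ₋)`, with `c` the Rankine-Hugoniot speed. -/
def h (f : ℝ → ℝ) (φm φp u : ℝ) : ℝ := -speed f φm φp * (u - φm) + f u - f φm

/-- `φ` is a (classical) solution of the travelling wave problem
`h(φ) = ε 𝒟^α[φ]` on `ℝ`, `φ(-∞) = φ₋`, `φ(+∞) = φ₊`. -/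
structure IsTravellingWave (α : ℝ) (f : ℝ → ℝ) (φm φp ε : ℝ) (φ : ℝ → ℝ) : Prop where
  contDiff : ContDiff ℝ 1 φ
  equation : ∀ ξ : ℝ, ∃ D : ℝ, HasFracDeriv α φ ξ D ∧ h f φm φp (φ ξ) = ε * D
  tendsto_atBot : Tendsto φ atBot (𝓝 φm)
  tendsto_atTop : Tendsto φ atTop (𝓝 φp)

/-- The exponential rate `λ_ε = (h'(φ₋) / ε)^(1/α)`. -/
def rate (α : ℝ) (f : ℝ → ℝ) (φm φp ε : ℝ) : ℝ :=
  (deriv (h f φm φp) φm / ε) ^ (1 / α)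

/-- The shock profile with jump at `ξ₀` (its value at `ξ₀` itself is irrelevant). -/
def shock (φm φp ξ₀ ξ : ℝ) : ℝ := if ξ < ξ₀ then φm else φp

end FracTW

end

namespace FracTW

open MeasureTheory Set

/-! ### The Marchaud form of the fractional derivative -/

/-! Integration by parts turns `𝒟^α` into the Marchaud form `c ∫ (g x - g (x - s)) s^(-1-α) ds`,
which is positive at a point where `g` is maximal over its past (unless `g` is constant there). With
`x = λ_ε (ξ - ξ₀)` the wave equation becomes `𝒟^α ψ = H(ψ)`, where `H = h / h'(φ₋)` has slope `1` at
`φ₋`. As `ε` has disappeared, everything reduces to properties of these normalised profiles.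

Left tail: `u = φ₋ - ψ` solves `𝒟^α u = u - r`, and convexity gives `0 ≤ r`, with `r ≤ K u²` for
small `u`. The symbol `p^α - 1` is divisible by `p - 1`: there is a positive kernel `k` of mass one
with `(𝒟^α - 1) u = (d/dx - 1)(k * u)` (`LeftTame.hasDerivAt_kconv`). Thus `U = k * u` solves the
ordinary differential equation `U' = U - r`; being bounded, it is positive. A maximum principle for
the positive weight `c s^(-1-α) - k(s)` transfers information from `U` to `u` and gives `u = A e^x +
O(e^(3x/2))` at `-∞` with `A > 0` (`exists_left_asymptotics`).

Ordering: a translation by `τ` multiplies the amplitude `A` by `e^τ`, and strict order near `-∞`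
persists everywhere because at a first contact the maximum principle contradicts the equation. Hence
profiles are strictly decreasing and determined by their value at one point (`IsProfile.unique`).
This uniqueness makes the constants independent of `ε`.

Right tail: the memory of the drop near the origin contributes at least a multiple of `x^(-α)`,
which gives the lower bound; a power barrier gives the upper one. The shock limit follows from the
uniform bounds and `λ_ε → ∞`. -/

/-- The Marchaud form of the fractional derivative of order `α`. -/
noncomputable def marchaud (α : ℝ) (g : ℝ → ℝ) (x : ℝ) : ℝ :=
  α / Real.Gamma (1 - α) * ∫ s in Ioi (0 : ℝ), (g x - g (x - s)) * s ^ (-1 - α)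

/-- Continuously differentiable functions that are bounded on every left half-line. -/
structure LeftTame (g : ℝ → ℝ) : Prop where
  contDiff : ContDiff ℝ 1 g
  bounded : ∀ x, ∃ B, ∀ y ≤ x, |g y| ≤ B

theorem marchaud_const_pos {α : ℝ} (hα0 : 0 < α) (hα1 : α < 1) :
    0 < α / Real.Gamma (1 - α) :=
  div_pos hα0 (Real.Gamma_pos_of_pos (by linarith))

/-- A linear bound at `0` reduces the singularity to `s^(-α)`, integrable since `α < 1`; boundedness
suffices at infinity since `α > 0`. -/
theorem integrableOn_mul_rpow {α : ℝ} (hα0 : 0 < α) (hα1 : α < 1) {F : ℝ → ℝ} {L B : ℝ}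
    (hF : AEStronglyMeasurable F (volume.restrict (Ioi 0)))
    (hL : ∀ s, 0 < s → s ≤ 1 → |F s| ≤ L * s) (hB : ∀ s, 1 < s → |F s| ≤ B) :
    IntegrableOn (fun s => F s * s ^ (-1 - α)) (Ioi 0) := by
  have hm : AEStronglyMeasurable (fun s : ℝ => F s * s ^ (-1 - α)) (volume.restrict (Ioi 0)) :=
    hF.mul (by fun_prop)
  rw [← Ioc_union_Ioi_eq_Ioi (zero_le_one (α := ℝ))]
  refine IntegrableOn.union ?_ ?_
  · have h1 : IntegrableOn (fun s : ℝ => L * s ^ (-α)) (Ioc 0 1) := by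
      have := (intervalIntegral.intervalIntegrable_rpow' (a := 0) (b := 1)
        (r := -α) (by linarith)).1
      exact this.const_mul L
    refine Integrable.mono' h1 (hm.mono_set Ioc_subset_Ioi_self) ?_
    refine (ae_restrict_iff' measurableSet_Ioc).2 (ae_of_all _ fun s hs => ?_)
    have hs0 : 0 < s := hs.1
    rw [Real.norm_eq_abs, abs_mul, abs_of_nonneg (Real.rpow_nonneg hs0.le _)]
    calc |F s| * s ^ (-1 - α) ≤ (L * s) * s ^ (-1 - α) := by
          gcongr
          exact hL s hs.1 hs.2
      _ = L * s ^ (-α) := by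
          have : s ^ (-α) = s ^ (1 : ℝ) * s ^ (-1 - α) := by
            rw [← Real.rpow_add hs0]; ring_nf
          rw [this, Real.rpow_one]; ring
  · have h1 : IntegrableOn (fun s : ℝ => B * s ^ (-1 - α)) (Ioi 1) :=
      (integrableOn_Ioi_rpow_of_lt (by linarith) one_pos).const_mul B
    refine Integrable.mono' h1 (hm.mono_set (Ioi_subset_Ioi zero_le_one)) ?_
    refine (ae_restrict_iff' measurableSet_Ioi).2 (ae_of_all _ fun s hs => ?_)
    have hs0 : (0 : ℝ) < s := zero_lt_one.trans hs
    rw [Real.norm_eq_abs, abs_mul, abs_of_nonneg (Real.rpow_nonneg hs0.le _)]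
    gcongr
    exact hB s hs

theorem exists_lipschitz_Icc {g : ℝ → ℝ} (hg : ContDiff ℝ 1 g) (a b : ℝ) :
    ∃ L, 0 ≤ L ∧ ∀ y ∈ Icc a b, ∀ z ∈ Icc a b, |g z - g y| ≤ L * |z - y| := by
  obtain ⟨L, hL⟩ := (isCompact_Icc (a := a) (b := b)).exists_bound_of_continuousOn
    (hg.continuous_deriv le_rfl).continuousOn
  refine ⟨max L 0, le_max_right _ _, fun y hy z hz => ?_⟩
  exact (convex_Icc a b).norm_image_sub_le_of_norm_deriv_le (f := g)
    (fun x _ => (hg.differentiable one_ne_zero).differentiableAt)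
    (fun x hx => (hL x hx).trans (le_max_left _ _)) hy hz

namespace LeftTame

variable {g g₁ g₂ : ℝ → ℝ}

theorem continuous (hg : LeftTame g) : Continuous g := hg.contDiff.continuous

theorem hasDerivAt (hg : LeftTame g) (x : ℝ) : HasDerivAt g (deriv g x) x :=
  (hg.contDiff.differentiable one_ne_zero x).hasDerivAt

theorem sub (h₁ : LeftTame g₁) (h₂ : LeftTame g₂) : LeftTame (fun x => g₁ x - g₂ x) := by
  refine ⟨h₁.contDiff.sub h₂.contDiff, fun x => ?_⟩
  obtain ⟨B₁, hB₁⟩ := h₁.bounded x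
  obtain ⟨B₂, hB₂⟩ := h₂.bounded x
  exact ⟨B₁ + B₂, fun y hy => (abs_sub _ _).trans (add_le_add (hB₁ y hy) (hB₂ y hy))⟩

theorem const_mul (hg : LeftTame g) (a : ℝ) : LeftTame (fun x => a * g x) := by
  refine ⟨contDiff_const.mul hg.contDiff, fun x => ?_⟩
  obtain ⟨B, hB⟩ := hg.bounded x
  refine ⟨|a| * B, fun y hy => ?_⟩
  rw [abs_mul]
  gcongr
  exact hB y hy

theorem const (a : ℝ) : LeftTame (fun _ => a) :=
  ⟨contDiff_const, fun _ => ⟨|a|, fun _ _ => le_rfl⟩⟩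

theorem exp_mul {ν : ℝ} (hν : 0 < ν) : LeftTame (fun x => Real.exp (ν * x)) := by
  refine ⟨by fun_prop, fun x => ⟨Real.exp (ν * x), fun y hy => ?_⟩⟩
  rw [abs_of_pos (Real.exp_pos _)]
  exact Real.exp_le_exp.2 (by gcongr)

theorem of_bounded {B : ℝ} (hg : ContDiff ℝ 1 g) (hB : ∀ x, |g x| ≤ B) : LeftTame g :=
  ⟨hg, fun _ => ⟨B, fun y _ => hB y⟩⟩

theorem integrableOn (hg : LeftTame g) {α : ℝ} (hα0 : 0 < α) (hα1 : α < 1) (x : ℝ) :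
    IntegrableOn (fun s => (g x - g (x - s)) * s ^ (-1 - α)) (Ioi 0) := by
  obtain ⟨L, hL0, hL⟩ := exists_lipschitz_Icc hg.contDiff (x - 1) x
  obtain ⟨B, hB⟩ := hg.bounded x
  have hc := hg.continuous
  refine integrableOn_mul_rpow hα0 hα1 (F := fun s => g x - g (x - s)) (L := L) (B := B + B)
    (by fun_prop) (fun s h0 h1 => ?_) (fun s h1 => ?_)
  · have := hL (x - s) ⟨by linarith, by linarith⟩ x ⟨by linarith, le_rfl⟩
    rwa [sub_sub_cancel, abs_of_pos h0] at this
  · exact (abs_sub _ _).trans (add_le_add (hB x le_rfl) (hB _ (by linarith)))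

/-- Integration by parts against the antiderivative `g x - g (x - s)` of `deriv g (x - s)`, which
vanishes at `s = 0`. The boundary term is `O(s^(1-α))` at `0` and `O(T^(-α))` at infinity, so
boundedness of `g` on the past replaces any integrability of `g'`. -/
theorem tendsto_caputo (hg : LeftTame g) {α : ℝ} (hα0 : 0 < α) (hα1 : α < 1) (x : ℝ) :
    Tendsto (fun a : ℝ => ∫ z in a..x, deriv g z / (x - z) ^ α) atBot
      (𝓝 (α * ∫ s in Ioi (0 : ℝ), (g x - g (x - s)) * s ^ (-1 - α))) := by
  have hc := hg.continuous
  have hdc : Continuous (deriv g) := hg.contDiff.continuous_deriv le_rfl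
  have hint := hg.integrableOn hα0 hα1 x
  obtain ⟨B, hB⟩ := hg.bounded x
  have key : ∀ T : ℝ, 0 ≤ T → ∫ s in (0 : ℝ)..T, deriv g (x - s) * s ^ (-α) =
      (g x - g (x - T)) * T ^ (-α)
        + α * ∫ s in (0 : ℝ)..T, (g x - g (x - s)) * s ^ (-1 - α) := by
    intro T hT
    have hi1 : IntervalIntegrable (fun s : ℝ => deriv g (x - s) * s ^ (-α)) volume 0 T :=
      (intervalIntegral.intervalIntegrable_rpow' (by linarith)).continuousOn_mul
        (by fun_prop)
    have hi2 : IntervalIntegrable (fun s => (g x - g (x - s)) * s ^ (-1 - α)) volume 0 T :=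
      (intervalIntegrable_iff_integrableOn_Ioc_of_le hT).2 (hint.mono_set Ioc_subset_Ioi_self)
    have hftc := intervalIntegral.integral_eq_sub_of_hasDerivAt_of_le
      (f := fun s => (g x - g (x - s)) * s ^ (-α))
      (f' := fun s => deriv g (x - s) * s ^ (-α) - α * ((g x - g (x - s)) * s ^ (-1 - α)))
      hT ?_ ?_ (hi1.sub (hi2.const_mul α))
    · rw [intervalIntegral.integral_sub hi1 (hi2.const_mul α),
        intervalIntegral.integral_const_mul] at hftc
      simp only [sub_zero, sub_self, zero_mul] at hftc
      linarith
    · intro s hs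
      rcases eq_or_lt_of_le hs.1 with h0 | h0
      · obtain ⟨L, hL0, hL⟩ := exists_lipschitz_Icc hg.contDiff (x - T) x
        subst h0
        refine ContinuousWithinAt.congr_of_eventuallyEq ?_ (EventuallyEq.refl _ _) rfl
        have hz : (g x - g (x - 0)) * (0 : ℝ) ^ (-α) = 0 := by simp
        rw [ContinuousWithinAt, hz]
        have hlim : Tendsto (fun s : ℝ => L * s ^ (1 - α)) (𝓝[Icc 0 T] 0) (𝓝 0) := by
          have : ContinuousAt (fun s : ℝ => L * s ^ (1 - α)) 0 :=
            continuousAt_const.mul (Real.continuousAt_rpow_const _ _ (Or.inr (by linarith)))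
          have h2 := this.tendsto.mono_left (nhdsWithin_le_nhds (s := Icc 0 T))
          simpa [Real.zero_rpow (by linarith : (1 - α) ≠ 0)] using h2
        refine squeeze_zero_norm' ?_ hlim
        filter_upwards [self_mem_nhdsWithin] with s hs
        rw [Real.norm_eq_abs, abs_mul, abs_of_nonneg (Real.rpow_nonneg hs.1 _)]
        have h1 := hL (x - s) ⟨by linarith [hs.2], by linarith [hs.1]⟩ x
          ⟨by linarith [hs.1, hs.2], le_rfl⟩
        rw [sub_sub_cancel, abs_of_nonneg hs.1] at h1
        rcases eq_or_lt_of_le hs.1 with h0 | h0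
        · rw [← h0]; simp [Real.zero_rpow (by linarith : (1 - α) ≠ 0)]
        · calc |g x - g (x - s)| * s ^ (-α) ≤ (L * s) * s ^ (-α) := by gcongr
            _ = L * s ^ (1 - α) := by
              rw [sub_eq_add_neg, Real.rpow_add h0, Real.rpow_one]; ring
      · refine ContinuousAt.continuousWithinAt ?_
        exact ContinuousAt.mul (by fun_prop)
          (Real.continuousAt_rpow_const _ _ (Or.inl h0.ne'))
    · intro s hs
      have h1 : HasDerivAt (fun s => g x - g (x - s)) (deriv g (x - s)) s := by
        have := ((hg.hasDerivAt (x - s)).comp s ((hasDerivAt_id s).const_sub x)).const_sub (g x)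
        simpa using this
      have h2 : HasDerivAt (fun s : ℝ => s ^ (-α)) (-α * s ^ (-α - 1)) s :=
        Real.hasDerivAt_rpow_const (Or.inl hs.1.ne')
      refine (h1.mul h2).congr_deriv ?_
      rw [show -α - 1 = -1 - α by ring]; ring
  have hT : Tendsto (fun a : ℝ => x - a) atBot atTop :=
    tendsto_atTop_add_const_left _ x tendsto_neg_atBot_atTop
  have hev : ∀ᶠ a : ℝ in atBot, (g x - g (x - (x - a))) * (x - a) ^ (-α)
        + α * ∫ s in (0 : ℝ)..(x - a), (g x - g (x - s)) * s ^ (-1 - α)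
        = ∫ z in a..x, deriv g z / (x - z) ^ α := by
    filter_upwards [eventually_le_atBot x] with a ha
    rw [← key (x - a) (by linarith)]
    have h1 := intervalIntegral.integral_comp_sub_left (a := 0) (b := x - a)
      (fun z => deriv g z / (x - z) ^ α) x
    simp only [sub_sub_cancel, sub_zero] at h1
    rw [← h1]
    refine intervalIntegral.integral_congr fun s hs => ?_
    rw [uIcc_of_le (by linarith)] at hs
    simp only [Real.rpow_neg hs.1, div_eq_mul_inv]
  refine Tendsto.congr' hev ?_
  rw [show α * ∫ s in Ioi (0 : ℝ), (g x - g (x - s)) * s ^ (-1 - α)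
    = 0 + α * ∫ s in Ioi (0 : ℝ), (g x - g (x - s)) * s ^ (-1 - α) by ring]
  refine Tendsto.add ?_ ((intervalIntegral_tendsto_integral_Ioi 0 hint hT).const_mul α)
  have hpow : Tendsto (fun a : ℝ => (B + B) * (x - a) ^ (-α)) atBot (𝓝 0) := by
    have := ((tendsto_rpow_neg_atTop hα0).comp hT).const_mul (B + B)
    simpa using this
  refine squeeze_zero_norm' ?_ hpow
  filter_upwards [eventually_le_atBot x] with a ha
  have hp : 0 ≤ (x - a) ^ (-α) := Real.rpow_nonneg (by linarith) _
  rw [Real.norm_eq_abs, abs_mul, abs_of_nonneg hp, sub_sub_cancel]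
  gcongr
  exact (abs_sub _ _).trans (add_le_add (hB x le_rfl) (hB a ha))

theorem hasFracDeriv (hg : LeftTame g) {α : ℝ} (hα0 : 0 < α) (hα1 : α < 1) (x : ℝ) :
    HasFracDeriv α g x (marchaud α g x) := by
  have := (hg.tendsto_caputo hα0 hα1 x).const_mul (1 / Real.Gamma (1 - α))
  rw [HasFracDeriv, marchaud]
  convert this using 2
  ring

theorem marchaud_sub (h₁ : LeftTame g₁) (h₂ : LeftTame g₂) {α : ℝ} (hα0 : 0 < α)
    (hα1 : α < 1) (x : ℝ) :
    marchaud α (fun y => g₁ y - g₂ y) x = marchaud α g₁ x - marchaud α g₂ x := by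
  rw [marchaud, marchaud, marchaud, ← mul_sub, ← integral_sub (h₁.integrableOn hα0 hα1 x)
    (h₂.integrableOn hα0 hα1 x)]
  congr 2
  ext s
  ring

end LeftTame

/-! ### Scaling and the maximum principle for the Marchaud form. -/

theorem marchaud_const (α a x : ℝ) : marchaud α (fun _ => a) x = 0 := by simp [marchaud]

/-- Affine change of the independent variable. -/
theorem marchaud_comp_affine (α : ℝ) (g : ℝ → ℝ) {b : ℝ} (hb : 0 < b) (d x : ℝ) :
    marchaud α (fun y => g (d + b * y)) x = b ^ α * marchaud α g (d + b * x) := by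
  have h1 := integral_comp_mul_left_Ioi
    (fun s => (g (d + b * x) - g (d + b * x - s)) * s ^ (-1 - α)) 0 hb
  rw [mul_zero, smul_eq_mul] at h1
  have h2 : ∫ s in Ioi (0 : ℝ), (g (d + b * x) - g (d + b * (x - s))) * s ^ (-1 - α)
      = b ^ (1 + α) * ∫ s in Ioi (0 : ℝ),
        (g (d + b * x) - g (d + b * x - b * s)) * (b * s) ^ (-1 - α) := by
    rw [← integral_const_mul]
    refine setIntegral_congr_fun measurableSet_Ioi fun s hs => ?_
    have hs : 0 < s := hs
    have h3 : b ^ (1 + α) * (b * s) ^ (-1 - α) = s ^ (-1 - α) := by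
      rw [Real.mul_rpow hb.le hs.le, ← mul_assoc, ← Real.rpow_add hb]
      simp
    rw [← h3, show d + b * (x - s) = d + b * x - b * s by ring]
    ring
  rw [marchaud, marchaud, h2, h1, Real.rpow_add hb, Real.rpow_one]
  field_simp

/-- Strict maximum principle: at a maximum over the past that is not attained throughout it,
the weighted integral of past differences is positive. -/
theorem integral_past_pos {w : ℝ → ℝ} (hw : ∀ s, 0 < s → 0 < w s) {g : ℝ → ℝ}
    (hg : Continuous g) {x : ℝ}
    (hint : IntegrableOn (fun s => (g x - g (x - s)) * w s) (Ioi 0))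
    (hmax : ∀ y ≤ x, g y ≤ g x) {y : ℝ} (hy : y < x) (hlt : g y < g x) :
    0 < ∫ s in Ioi (0 : ℝ), (g x - g (x - s)) * w s := by
  have hnn : 0 ≤ᵐ[volume.restrict (Ioi (0 : ℝ))] fun s => (g x - g (x - s)) * w s := by
    refine (ae_restrict_iff' measurableSet_Ioi).2 (ae_of_all _ fun s hs => ?_)
    have hs : 0 < s := hs
    exact mul_nonneg (sub_nonneg.2 (hmax _ (by linarith))) (hw s hs).le
  rw [setIntegral_pos_iff_support_of_nonneg_ae hnn hint]
  have hopen : IsOpen ({s : ℝ | g (x - s) < g x} ∩ Ioi 0) :=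
    (isOpen_lt (by fun_prop) continuous_const).inter isOpen_Ioi
  have hpos : 0 < volume ({s : ℝ | g (x - s) < g x} ∩ Ioi 0) :=
    hopen.measure_pos _ ⟨x - y, by simpa using hlt, by simpa using hy⟩
  refine hpos.trans_le (measure_mono fun s hs => ⟨?_, hs.2⟩)
  exact mul_ne_zero (sub_ne_zero.2 (ne_of_gt hs.1)) (hw s hs.2).ne'

theorem marchaud_pos_of_max {α : ℝ} (hα0 : 0 < α) (hα1 : α < 1) {g : ℝ → ℝ} (hg : LeftTame g)
    {x : ℝ} (hmax : ∀ y ≤ x, g y ≤ g x) {y : ℝ} (hy : y < x) (hlt : g y < g x) :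
    0 < marchaud α g x :=
  mul_pos (marchaud_const_pos hα0 hα1) (integral_past_pos (fun _ hs => Real.rpow_pos_of_pos hs _)
    hg.continuous (hg.integrableOn hα0 hα1 x) hmax hy hlt)

/-- A continuous function vanishing at `-∞` attains a positive supremum over a left half-line. -/
theorem exists_max_past {g : ℝ → ℝ} (hg : Continuous g) (hlim : Tendsto g atBot (𝓝 0)) {x : ℝ}
    (hx : 0 < g x) : ∃ x' ≤ x, g x ≤ g x' ∧ ∀ y ≤ x, g y ≤ g x' := by
  obtain ⟨a, ha⟩ := eventually_atBot.1 (hlim.eventually (eventually_lt_nhds hx))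
  have hax : a ≤ x := by
    by_contra hcon
    exact lt_irrefl _ (ha x (by linarith))
  obtain ⟨x', hx', hmax⟩ := isCompact_Icc.exists_isMaxOn (nonempty_Icc.2 hax) hg.continuousOn
  refine ⟨x', hx'.2, hmax ⟨hax, le_rfl⟩, fun y hy => ?_⟩
  rcases le_or_gt a y with h1 | h1
  · exact hmax ⟨h1, hy⟩
  · exact (ha y h1.le).le.trans (hmax ⟨hax, le_rfl⟩)

theorem exists_lt_past {g : ℝ → ℝ} (hlim : Tendsto g atBot (𝓝 0)) {x : ℝ}
    (hx : 0 < g x) : ∃ y < x, g y < g x := by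
  obtain ⟨a, ha⟩ := eventually_atBot.1 (hlim.eventually (eventually_lt_nhds hx))
  exact ⟨min a (x - 1), (min_le_right _ _).trans_lt (by linarith), ha _ (min_le_left _ _)⟩

/-! ### The kernel factorising `𝒟^α - 1` through `d/dx - 1` -/

/-- The kernel `k` for which `(𝒟^α - 1) u = (d/dx - 1) (k * u)`. -/
noncomputable def kernel (α s : ℝ) : ℝ :=
  α / Real.Gamma (1 - α) * ∫ t in Ioi s, Real.exp (-(t - s)) * t ^ (-1 - α)

/-- The exponential is an eigenfunction of `𝒟^α` with eigenvalue `1`: at `x = 0` its Caputo integral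
is Euler's integral for `Γ(1 - α)`, and this limit must agree with the Marchaud one. The identity
also gives `kernel` total mass one. -/
theorem marchaud_exp {α : ℝ} (hα0 : 0 < α) (hα1 : α < 1) :
    α / Real.Gamma (1 - α) * ∫ s in Ioi (0 : ℝ), (1 - Real.exp (-s)) * s ^ (-1 - α) = 1 := by
  have hexp : LeftTame Real.exp := by simpa using LeftTame.exp_mul one_pos
  have h1 := hexp.tendsto_caputo hα0 hα1 0
  have hG := Real.GammaIntegral_convergent (s := 1 - α) (by linarith)
  have h2 := intervalIntegral_tendsto_integral_Ioi 0 hG tendsto_neg_atBot_atTop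
  have h3 : Tendsto (fun a : ℝ => ∫ z in a..0, deriv Real.exp z / (0 - z) ^ α) atBot
      (𝓝 (∫ s in Ioi (0 : ℝ), Real.exp (-s) * s ^ (1 - α - 1))) := by
    refine h2.congr' ?_
    filter_upwards [eventually_le_atBot 0] with a ha
    have h4 := intervalIntegral.integral_comp_neg (a := 0) (b := -a)
      (fun z => deriv Real.exp z / (0 - z) ^ α)
    simp only [neg_neg, neg_zero] at h4
    rw [← h4]
    refine intervalIntegral.integral_congr fun s hs => ?_
    rw [uIcc_of_le (by linarith)] at hs
    simp only [Real.deriv_exp, zero_sub, neg_neg]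
    rw [show 1 - α - 1 = -α by ring, Real.rpow_neg hs.1, div_eq_mul_inv]
  have h5 := tendsto_nhds_unique h1 h3
  rw [← Real.Gamma_eq_integral (by linarith)] at h5
  simp only [Real.exp_zero, zero_sub] at h5
  have hpos := Real.Gamma_pos_of_pos (show 0 < 1 - α by linarith)
  rw [div_mul_eq_mul_div, h5, div_self hpos.ne']

theorem integrableOn_one_sub_exp {α : ℝ} (hα0 : 0 < α) (hα1 : α < 1) :
    IntegrableOn (fun s : ℝ => (1 - Real.exp (-s)) * s ^ (-1 - α)) (Ioi 0) := by
  have hexp : LeftTame Real.exp := by simpa using LeftTame.exp_mul one_pos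
  simpa using hexp.integrableOn hα0 hα1 0

theorem integral_exp_sub (t : ℝ) : ∫ s in (0 : ℝ)..t, Real.exp (-(t - s)) = 1 - Real.exp (-t) := by
  have := intervalIntegral.integral_comp_sub_left (a := 0) (b := t) (fun y => Real.exp (-y)) t
  rw [this]
  simp [intervalIntegral.integral_comp_neg (fun y => Real.exp y)]

/-- Tonelli with the `s`-integral taken first: it leaves `(1 - e^(-t)) t^(-1-α)`, in which the
singularity at `0` is already integrable. -/
theorem integrable_kernel_prod {α : ℝ} (hα0 : 0 < α) (hα1 : α < 1) :
    Integrable (fun p : ℝ × ℝ =>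
      (Ioi p.1).indicator (fun t => Real.exp (-(t - p.1)) * t ^ (-1 - α)) p.2)
      ((volume.restrict (Ioi 0)).prod (volume.restrict (Ioi 0))) := by
  have hmeas : Measurable (fun p : ℝ × ℝ =>
      (Ioi p.1).indicator (fun t => Real.exp (-(t - p.1)) * t ^ (-1 - α)) p.2) := by
    have : (fun p : ℝ × ℝ =>
      (Ioi p.1).indicator (fun t => Real.exp (-(t - p.1)) * t ^ (-1 - α)) p.2)
      = {p : ℝ × ℝ | p.1 < p.2}.indicator
        (fun p => Real.exp (-(p.2 - p.1)) * p.2 ^ (-1 - α)) := by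
      ext p
      simp [indicator]
    rw [this]
    exact Measurable.indicator (by fun_prop) (measurableSet_lt measurable_fst measurable_snd)
  have hswap : ∀ t : ℝ, (fun s : ℝ => (Ioi s).indicator
      (fun t => Real.exp (-(t - s)) * t ^ (-1 - α)) t)
      = (Iio t).indicator (fun s => Real.exp (-(t - s)) * t ^ (-1 - α)) := by
    intro t
    ext s
    simp [indicator]
  rw [integrable_prod_iff' hmeas.aestronglyMeasurable]
  have hIo : ∀ t : ℝ, 0 < t → IntegrableOn (fun s => Real.exp (-(t - s)) * t ^ (-1 - α))
      (Iio t ∩ Ioi 0) := by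
    intro t ht
    have : IntegrableOn (fun s => Real.exp (-(t - s)) * t ^ (-1 - α)) (Icc 0 t) :=
      (by fun_prop : Continuous fun s => Real.exp (-(t - s)) * t ^ (-1 - α)).integrableOn_Icc
    exact this.mono_set fun s hs => ⟨le_of_lt hs.2, le_of_lt hs.1⟩
  constructor
  · refine (ae_restrict_iff' measurableSet_Ioi).2 (ae_of_all _ fun t ht => ?_)
    simp only [hswap]
    rw [integrable_indicator_iff measurableSet_Iio, IntegrableOn,
      Measure.restrict_restrict measurableSet_Iio]
    exact hIo t ht
  · refine (integrableOn_one_sub_exp hα0 hα1).congr ?_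
    refine (ae_restrict_iff' measurableSet_Ioi).2 (ae_of_all _ fun t ht => ?_)
    have ht : 0 < t := ht
    simp only [norm_indicator_eq_indicator_norm]
    have : (fun s : ℝ => (Ioi s).indicator
        (fun t => ‖Real.exp (-(t - s)) * t ^ (-1 - α)‖) t)
        = (Iio t).indicator (fun s => Real.exp (-(t - s)) * t ^ (-1 - α)) := by
      ext s
      simp [indicator, abs_of_nonneg (Real.rpow_nonneg ht.le _)]
    rw [this, integral_indicator measurableSet_Iio, Measure.restrict_restrict measurableSet_Iio,
      Iio_inter_Ioi, ← integral_Ioc_eq_integral_Ioo, ← intervalIntegral.integral_of_le ht.le,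
      intervalIntegral.integral_mul_const, integral_exp_sub]

/-- Fubini for integrals against the kernel. -/
theorem kernel_fubini {α : ℝ} (hα0 : 0 < α) (hα1 : α < 1) {g : ℝ → ℝ} (hg : Continuous g) {B : ℝ}
    (hB : ∀ s, 0 < s → |g s| ≤ B) :
    IntegrableOn (fun s => kernel α s * g s) (Ioi 0) ∧
    ∫ s in Ioi (0 : ℝ), kernel α s * g s = α / Real.Gamma (1 - α) *
      ∫ t in Ioi (0 : ℝ), (∫ s in (0 : ℝ)..t, Real.exp (-(t - s)) * g s) * t ^ (-1 - α) := by
  set μ : Measure ℝ := volume.restrict (Ioi 0) with hμ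
  have hprod : Integrable (fun p : ℝ × ℝ =>
      (Ioi p.1).indicator (fun t => Real.exp (-(t - p.1)) * t ^ (-1 - α)) p.2 * g p.1)
      (μ.prod μ) := by
    refine (integrable_kernel_prod hα0 hα1).mul_bdd (c := B) (by fun_prop) ?_
    rw [hμ, Measure.prod_restrict]
    refine (ae_restrict_iff' (measurableSet_Ioi.prod measurableSet_Ioi)).2
      (ae_of_all _ fun p hp => hB _ hp.1)
  have hinner : ∀ s : ℝ, 0 < s → ∫ t, (Ioi s).indicator
      (fun t => Real.exp (-(t - s)) * t ^ (-1 - α)) t * g s ∂μ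
      = (∫ t in Ioi s, Real.exp (-(t - s)) * t ^ (-1 - α)) * g s := by
    intro s hs
    rw [integral_mul_const, integral_indicator measurableSet_Ioi, hμ,
      Measure.restrict_restrict measurableSet_Ioi, Ioi_inter_Ioi, sup_eq_left.2 hs.le]
  have hinner' : ∀ t : ℝ, 0 < t → ∫ s, (Ioi s).indicator
      (fun t => Real.exp (-(t - s)) * t ^ (-1 - α)) t * g s ∂μ
      = (∫ s in (0 : ℝ)..t, Real.exp (-(t - s)) * g s) * t ^ (-1 - α) := by
    intro t ht
    have : (fun s : ℝ => (Ioi s).indicator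
        (fun t => Real.exp (-(t - s)) * t ^ (-1 - α)) t * g s)
        = (Iio t).indicator (fun s => Real.exp (-(t - s)) * g s * t ^ (-1 - α)) := by
      ext s
      by_cases hst : s < t
      · simp [indicator, hst]; ring
      · simp [indicator, hst]
    rw [this, integral_indicator measurableSet_Iio, hμ,
      Measure.restrict_restrict measurableSet_Iio,
      Iio_inter_Ioi, ← integral_Ioc_eq_integral_Ioo, ← intervalIntegral.integral_of_le ht.le,
      intervalIntegral.integral_mul_const]
  constructor
  · have := (hprod.integral_prod_left).const_mul (α / Real.Gamma (1 - α))
    refine this.congr ?_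
    rw [hμ]
    refine (ae_restrict_iff' measurableSet_Ioi).2 (ae_of_all _ fun s hs => ?_)
    simp only
    rw [hinner s hs, kernel, mul_assoc]
  · have hsw := integral_integral_swap (μ := μ) (ν := μ) (f := fun s t => (Ioi s).indicator
      (fun t => Real.exp (-(t - s)) * t ^ (-1 - α)) t * g s) hprod
    have h1 : ∫ s in Ioi (0 : ℝ), kernel α s * g s = α / Real.Gamma (1 - α) *
        ∫ s, ∫ t, (Ioi s).indicator
        (fun t => Real.exp (-(t - s)) * t ^ (-1 - α)) t * g s ∂μ ∂μ := by
      rw [← integral_const_mul]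
      refine setIntegral_congr_fun measurableSet_Ioi fun s hs => ?_
      rw [hinner s hs, kernel, mul_assoc]
    rw [h1, hsw]
    congr 1
    exact setIntegral_congr_fun measurableSet_Ioi fun t ht => hinner' t ht

theorem integrableOn_kernel {α : ℝ} (hα0 : 0 < α) (hα1 : α < 1) :
    IntegrableOn (kernel α) (Ioi 0) := by
  simpa using (kernel_fubini hα0 hα1 (g := fun _ => 1) continuous_const (B := 1) (by simp)).1

theorem integral_kernel {α : ℝ} (hα0 : 0 < α) (hα1 : α < 1) :
    ∫ s in Ioi (0 : ℝ), kernel α s = 1 := by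
  have := (kernel_fubini hα0 hα1 (g := fun _ => 1) continuous_const (B := 1) (by simp)).2
  simp only [mul_one, integral_exp_sub] at this
  rw [this, marchaud_exp hα0 hα1]

/-! ### Pointwise estimates of the kernel and of the weight. -/

theorem integrableOn_exp_sub (s : ℝ) : IntegrableOn (fun t => Real.exp (-(t - s))) (Ioi s) := by
  have := (integrableOn_exp_neg_Ioi s).const_mul (Real.exp s)
  refine this.congr (ae_of_all _ fun t => ?_)
  simp only
  rw [← Real.exp_add]; ring_nf

theorem integral_exp_sub_Ioi (s a : ℝ) :
    ∫ t in Ioi a, Real.exp (-(t - s)) = Real.exp (-(a - s)) := by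
  have h1 : ∀ t, Real.exp (-(t - s)) = Real.exp s * Real.exp (-t) := fun t => by
    rw [← Real.exp_add]; ring_nf
  simp only [h1]
  rw [integral_const_mul, integral_exp_neg_Ioi]

theorem rpow_antitone_neg {α : ℝ} (hα0 : 0 < α) {s t : ℝ} (hs : 0 < s) (hst : s ≤ t) :
    t ^ (-1 - α) ≤ s ^ (-1 - α) :=
  Real.rpow_le_rpow_of_nonpos hs hst (by linarith)

theorem integrableOn_kernel_integrand {α : ℝ} (hα0 : 0 < α) {s : ℝ} (hs : 0 < s) :
    IntegrableOn (fun t => Real.exp (-(t - s)) * t ^ (-1 - α)) (Ioi s) := by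
  refine Integrable.mono' ((integrableOn_exp_sub s).mul_const (s ^ (-1 - α)))
    (Measurable.aestronglyMeasurable (by fun_prop)) ?_
  refine (ae_restrict_iff' measurableSet_Ioi).2 (ae_of_all _ fun t ht => ?_)
  have ht : s < t := ht
  rw [Real.norm_eq_abs, abs_mul, abs_of_pos (Real.exp_pos _),
    abs_of_nonneg (Real.rpow_nonneg (hs.trans ht).le _)]
  exact mul_le_mul_of_nonneg_left (rpow_antitone_neg hα0 hs ht.le) (Real.exp_pos _).le

theorem kernel_pos {α : ℝ} (hα0 : 0 < α) (hα1 : α < 1) {s : ℝ} (hs : 0 < s) : 0 < kernel α s := by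
  refine mul_pos (marchaud_const_pos hα0 hα1) ?_
  have hnn : 0 ≤ᵐ[volume.restrict (Ioi s)] fun t => Real.exp (-(t - s)) * t ^ (-1 - α) := by
    refine (ae_restrict_iff' measurableSet_Ioi).2 (ae_of_all _ fun t ht => ?_)
    exact mul_nonneg (Real.exp_pos _).le (Real.rpow_nonneg (hs.trans ht).le _)
  rw [setIntegral_pos_iff_support_of_nonneg_ae hnn (integrableOn_kernel_integrand hα0 hs)]
  have hpos : 0 < volume (Ioi s) := isOpen_Ioi.measure_pos _ nonempty_Ioi
  refine hpos.trans_le (measure_mono fun t ht => ⟨?_, ht⟩)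
  exact (mul_pos (Real.exp_pos _) (Real.rpow_pos_of_pos (hs.trans ht) _)).ne'

/-- The remaining weight `c s^{-1-α} - k(s)`. -/
noncomputable def weight (α s : ℝ) : ℝ :=
  α / Real.Gamma (1 - α) * s ^ (-1 - α) - kernel α s

/-- `e^(-(t-s))` is a probability density on `(s, ∞)`, so the kernel is an average of `c t^(-1-α)`.
The mass `e^(-1)` beyond `s + 1` sees values smaller by a factor `s / (s + 1) = 1 - 1 / (s + 1)`,
which produces a quantitative gap below `c s^(-1-α)`. -/
theorem kernel_le {α : ℝ} (hα0 : 0 < α) (hα1 : α < 1) {s : ℝ} (hs : 0 < s) :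
    kernel α s ≤ α / Real.Gamma (1 - α) * s ^ (-1 - α) * (1 - Real.exp (-1) / (s + 1)) := by
  have hc := marchaud_const_pos hα0 hα1
  rw [kernel, mul_assoc]
  gcongr
  have hint := integrableOn_kernel_integrand hα0 hs
  have hsub : Ioc s (s + 1) ∪ Ioi (s + 1) = Ioi s := Ioc_union_Ioi_eq_Ioi (by linarith)
  have hdis : Disjoint (Ioc s (s + 1)) (Ioi (s + 1)) := Ioc_disjoint_Ioi le_rfl
  have hi1 : IntegrableOn (fun t => Real.exp (-(t - s)) * t ^ (-1 - α)) (Ioc s (s + 1)) :=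
    hint.mono_set (hsub ▸ subset_union_left)
  have hi2 : IntegrableOn (fun t => Real.exp (-(t - s)) * t ^ (-1 - α)) (Ioi (s + 1)) :=
    hint.mono_set (hsub ▸ subset_union_right)
  have he := integrableOn_exp_sub s
  have he1 : IntegrableOn (fun t => Real.exp (-(t - s))) (Ioc s (s + 1)) :=
    he.mono_set (hsub ▸ subset_union_left)
  have he2 : IntegrableOn (fun t => Real.exp (-(t - s))) (Ioi (s + 1)) :=
    he.mono_set (hsub ▸ subset_union_right)
  have hE : ∫ t in Ioc s (s + 1), Real.exp (-(t - s)) = 1 - Real.exp (-1) := by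
    have h1 := setIntegral_union hdis measurableSet_Ioi he1 he2
    rw [hsub, integral_exp_sub_Ioi, integral_exp_sub_Ioi] at h1
    simp only [sub_self, neg_zero, Real.exp_zero, add_sub_cancel_left] at h1
    linarith
  have hE2 : ∫ t in Ioi (s + 1), Real.exp (-(t - s)) = Real.exp (-1) := by
    rw [integral_exp_sub_Ioi]; simp
  rw [← hsub, setIntegral_union hdis measurableSet_Ioi hi1 hi2]
  have hb1 : ∫ t in Ioc s (s + 1), Real.exp (-(t - s)) * t ^ (-1 - α)
      ≤ (1 - Real.exp (-1)) * s ^ (-1 - α) := by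
    rw [← hE, ← integral_mul_const]
    refine setIntegral_mono_on hi1 (he1.mul_const _) measurableSet_Ioc fun t ht => ?_
    exact mul_le_mul_of_nonneg_left (rpow_antitone_neg hα0 hs ht.1.le) (Real.exp_pos _).le
  have hb2 : ∫ t in Ioi (s + 1), Real.exp (-(t - s)) * t ^ (-1 - α)
      ≤ Real.exp (-1) * (s ^ (-1 - α) * (s / (s + 1))) := by
    rw [← hE2, ← integral_mul_const]
    refine setIntegral_mono_on hi2 (he2.mul_const _) measurableSet_Ioi fun t ht => ?_
    have ht : s + 1 < t := ht
    gcongr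
    have hst : 0 < t := by linarith
    have e1 : t ^ (-1 - α) = t ^ (-α) / t := by
      rw [show -1 - α = -α - 1 by ring, Real.rpow_sub_one hst.ne']
    have e2 : s ^ (-1 - α) = s ^ (-α) / s := by
      rw [show -1 - α = -α - 1 by ring, Real.rpow_sub_one hs.ne']
    rw [e1, e2, show s ^ (-α) / s * (s / (s + 1)) = s ^ (-α) / (s + 1) by field_simp]
    have hle : t ^ (-α) ≤ s ^ (-α) := Real.rpow_le_rpow_of_nonpos hs (by linarith) (by linarith)
    have := Real.rpow_nonneg hs.le (-α)
    gcongr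
  refine (add_le_add hb1 hb2).trans (le_of_eq ?_)
  field_simp
  ring

/-- The gap in `kernel_le` is at least `e^(-1) / (s + 1)` of `c s^(-1-α)`, which itself dominates
the kernel. On bounded ranges of `s` the weight thus controls the kernel. -/
theorem kernel_le_weight {α : ℝ} (hα0 : 0 < α) (hα1 : α < 1) {s : ℝ} (hs : 0 < s) :
    kernel α s ≤ Real.exp 1 * (s + 1) * weight α s := by
  have h1 := kernel_le hα0 hα1 hs
  set C := α / Real.Gamma (1 - α) * s ^ (-1 - α) with hC
  have hk := kernel_pos hα0 hα1 hs
  have hC0 : 0 < C := mul_pos (marchaud_const_pos hα0 hα1) (Real.rpow_pos_of_pos hs _)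
  have he : Real.exp 1 * Real.exp (-1) = 1 := by rw [← Real.exp_add]; simp
  have hw : C * (Real.exp (-1) / (s + 1)) ≤ weight α s := by
    rw [weight, ← hC]; linarith
  calc kernel α s ≤ C := by
        have : 0 < C * (Real.exp (-1) / (s + 1)) := by positivity
        linarith
    _ = Real.exp 1 * (s + 1) * (C * (Real.exp (-1) / (s + 1))) := by
        have : s + 1 ≠ 0 := by linarith
        field_simp
        exact he.symm
    _ ≤ _ := by gcongr

theorem weight_pos {α : ℝ} (hα0 : 0 < α) (hα1 : α < 1) {s : ℝ} (hs : 0 < s) : 0 < weight α s := by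
  have h1 := kernel_le_weight hα0 hα1 hs
  have hk := kernel_pos hα0 hα1 hs
  by_contra hcon
  have : Real.exp 1 * (s + 1) * weight α s ≤ 0 :=
    mul_nonpos_of_nonneg_of_nonpos (by positivity) (not_lt.1 hcon)
  linarith

/-! ### Convolution with the kernel. -/

/-- The convolution of `u` with the kernel. -/
noncomputable def kconv (α : ℝ) (u : ℝ → ℝ) (x : ℝ) : ℝ :=
  ∫ s in Ioi (0 : ℝ), kernel α s * u (x - s)

namespace LeftTame

variable {α : ℝ} {u : ℝ → ℝ}

theorem integrableOn_kconv (hu : LeftTame u) (hα0 : 0 < α) (hα1 : α < 1) (x : ℝ) :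
    IntegrableOn (fun s => kernel α s * u (x - s)) (Ioi 0) := by
  obtain ⟨B, hB⟩ := hu.bounded x
  have := hu.continuous
  exact (kernel_fubini hα0 hα1 (g := fun s => u (x - s)) (by fun_prop)
    fun s hs => hB _ (by linarith)).1

theorem integrableOn_kernel_sub (hu : LeftTame u) (hα0 : 0 < α) (hα1 : α < 1) (x : ℝ) :
    IntegrableOn (fun s => kernel α s * (u x - u (x - s))) (Ioi 0) := by
  have := ((integrableOn_kernel hα0 hα1).mul_const (u x)).sub (hu.integrableOn_kconv hα0 hα1 x)
  refine this.congr (ae_of_all _ fun s => ?_)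
  simp only [Pi.sub_apply]; ring

theorem integral_kernel_sub (hu : LeftTame u) (hα0 : 0 < α) (hα1 : α < 1) (x : ℝ) :
    ∫ s in Ioi (0 : ℝ), kernel α s * (u x - u (x - s)) = u x - kconv α u x := by
  simp only [mul_sub]
  rw [integral_sub ((integrableOn_kernel hα0 hα1).mul_const (u x))
    (hu.integrableOn_kconv hα0 hα1 x), integral_mul_const, integral_kernel hα0 hα1, one_mul, kconv]

/-- When `marchaud α u = u - r`, the right-hand side is `kconv α u x - r x`: the linear term
cancels, and the weight operator links `u` to its smoothed version. -/
theorem weight_identity (hu : LeftTame u) (hα0 : 0 < α) (hα1 : α < 1) (x : ℝ) :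
    IntegrableOn (fun s => (u x - u (x - s)) * weight α s) (Ioi 0) ∧
    ∫ s in Ioi (0 : ℝ), (u x - u (x - s)) * weight α s
      = marchaud α u x - u x + kconv α u x := by
  have h1 := (hu.integrableOn hα0 hα1 x).const_mul (α / Real.Gamma (1 - α))
  have h2 := hu.integrableOn_kernel_sub hα0 hα1 x
  have he : (fun s => (u x - u (x - s)) * weight α s) = fun s =>
      α / Real.Gamma (1 - α) * ((u x - u (x - s)) * s ^ (-1 - α))
        - kernel α s * (u x - u (x - s)) := by
    ext s
    rw [weight]; ring
  rw [he]
  refine ⟨h1.sub h2, ?_⟩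
  rw [integral_sub h1 h2, integral_const_mul, hu.integral_kernel_sub hα0 hα1 x, marchaud]
  ring

/-- The factorisation `(d/dx - 1)(k * u) = (𝒟^α - 1) u`. With `v = e^(-y) u` and a primitive `E` of
`v`, Fubini gives `k * u = e^y c ∫ e^(-t) (E y - E (y - t)) t^(-1-α) dt`. Since `E` is smoother than
`u`, the integral may be differentiated; `e^y` returns `k * u`, and the differentiated integrand
gives `𝒟^α u - u` by `marchaud_exp`. -/
theorem hasDerivAt_kconv (hu : LeftTame u) (hα0 : 0 < α) (hα1 : α < 1) (x : ℝ) :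
    HasDerivAt (kconv α u) (kconv α u x + marchaud α u x - u x) x := by
  have huc := hu.continuous
  set v : ℝ → ℝ := fun y => Real.exp (-y) * u y with hv
  have hvc : Continuous v := by fun_prop
  have hvd : ContDiff ℝ 1 v := by
    have := hu.contDiff
    fun_prop
  set E : ℝ → ℝ := fun y => ∫ z in (0 : ℝ)..y, v z with hE
  have hEd : ∀ y, HasDerivAt E (v y) y := fun y =>
    intervalIntegral.integral_hasDerivAt_right (hvc.intervalIntegrable _ _)
      (hvc.stronglyMeasurableAtFilter _ _) hvc.continuousAt
  have hEc : Continuous E := continuous_iff_continuousAt.2 fun y => (hEd y).continuousAt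
  have hEC : ContDiff ℝ 1 E := by
    rw [contDiff_one_iff_deriv]
    refine ⟨fun y => (hEd y).differentiableAt, ?_⟩
    rw [show deriv E = v from funext fun y => (hEd y).deriv]
    exact hvc
  set c := α / Real.Gamma (1 - α) with hc
  set Hf : ℝ → ℝ → ℝ := fun y t => Real.exp (-t) * (E y - E (y - t)) * t ^ (-1 - α) with hHf
  have hJ : ∀ y t, Real.exp (-t) * (E y - E (y - t))
      = Real.exp (-y) * ∫ s in (0 : ℝ)..t, Real.exp (-(t - s)) * u (y - s) := by
    intro y t
    have h2 : ∫ s in (0 : ℝ)..t, v (y - s) = E y - E (y - t) := by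
      rw [intervalIntegral.integral_comp_sub_left (fun s => v s) y, sub_zero, hE]
      simp only
      rw [intervalIntegral.integral_interval_sub_left] <;> exact hvc.intervalIntegrable _ _
    rw [← h2, ← intervalIntegral.integral_const_mul, ← intervalIntegral.integral_const_mul]
    refine intervalIntegral.integral_congr fun s _ => ?_
    rw [hv]
    simp only
    rw [← mul_assoc, ← mul_assoc, ← Real.exp_add, ← Real.exp_add]
    ring_nf
  have hrep : ∀ y, kconv α u y = Real.exp y * (c * ∫ t in Ioi (0 : ℝ), Hf y t) := by
    intro y
    obtain ⟨B, hB⟩ := hu.bounded y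
    have := (kernel_fubini hα0 hα1 (g := fun s => u (y - s)) (by fun_prop) (B := B)
      fun s hs => hB _ (by linarith)).2
    rw [kconv, this, mul_left_comm, ← integral_const_mul (Real.exp y)]
    refine congrArg (c * ·) ?_
    refine setIntegral_congr_fun measurableSet_Ioi fun t _ => ?_
    rw [hHf]
    simp only
    rw [hJ, ← mul_assoc, ← mul_assoc, ← Real.exp_add, add_neg_cancel, Real.exp_zero, one_mul]
  obtain ⟨B, hB⟩ := hu.bounded (x + 1)
  have hB0 : 0 ≤ B := (abs_nonneg _).trans (hB x (by linarith))
  obtain ⟨L, hL0, hL⟩ := exists_lipschitz_Icc hvd (x - 2) (x + 1)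
  obtain ⟨L', hL0', hL'⟩ := exists_lipschitz_Icc hEC (x - 2) (x + 1)
  -- The factor `e^(-t)` compensates the growth of `v (y - t)`, leaving `e^(-y)` times bounded
  -- terms, and `y > x - 1`.
  have hvB : ∀ y ∈ Metric.ball x 1, ∀ t, 0 < t →
      |Real.exp (-t) * (v y - v (y - t))| ≤ 2 * B * Real.exp (1 - x) := by
    intro y hy t ht
    rw [Metric.mem_ball, Real.dist_eq, abs_lt] at hy
    have e1 : Real.exp (-t) * (v y - v (y - t))
        = Real.exp (-y) * (Real.exp (-t) * u y - u (y - t)) := by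
      rw [hv]; simp only
      rw [mul_sub, mul_sub, ← mul_assoc, ← mul_assoc, ← mul_assoc, ← Real.exp_add,
        ← Real.exp_add, ← Real.exp_add]
      ring_nf
    rw [e1, abs_mul, abs_of_pos (Real.exp_pos _), mul_comm (2 * B)]
    have h1 := hB y (by linarith)
    have h2 := hB (y - t) (by linarith)
    have h3 : Real.exp (-t) ≤ 1 := Real.exp_le_one_iff.2 (by linarith)
    have h4 : |Real.exp (-t) * u y| ≤ B := by
      rw [abs_mul, abs_of_pos (Real.exp_pos _)]
      calc _ ≤ 1 * B := by gcongr
        _ = B := one_mul B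
    gcongr
    · linarith
    · exact (abs_sub _ _).trans (by linarith)
  have hder := (hasDerivAt_integral_of_dominated_loc_of_deriv_le
    (μ := volume.restrict (Ioi (0 : ℝ))) (F := Hf)
    (F' := fun y t => Real.exp (-t) * (v y - v (y - t)) * t ^ (-1 - α))
    (x₀ := x) (s := Metric.ball x 1)
    (bound := fun t => (if t ≤ 1 then L * t else 2 * B * Real.exp (1 - x)) * t ^ (-1 - α))
    (Metric.ball_mem_nhds x one_pos) ?_ ?_ ?_ ?_ ?_ ?_).2
  · have h1 := (Real.hasDerivAt_exp x).mul (hder.const_mul c)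
    have h2 : kconv α u = fun y => Real.exp y * (c * ∫ t in Ioi (0 : ℝ), Hf y t) := funext hrep
    rw [h2]
    refine h1.congr_deriv ?_
    have h3 : Real.exp x * (c * ∫ t in Ioi (0 : ℝ), Real.exp (-t) * (v x - v (x - t)) * t ^ (-1 - α))
        = marchaud α u x - u x := by
      have e0 := hu.integrableOn hα0 hα1 x
      have e2 := (integrableOn_one_sub_exp hα0 hα1).mul_const (u x)
      have e1 : ∀ t : ℝ, Real.exp x * (Real.exp (-t) * (v x - v (x - t)) * t ^ (-1 - α))
          = (u x - u (x - t)) * t ^ (-1 - α) - (1 - Real.exp (-t)) * t ^ (-1 - α) * u x := by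
        intro t
        have a1 : Real.exp x * v x = u x := by
          rw [hv]; simp only; rw [← mul_assoc, ← Real.exp_add]; simp
        have a2 : Real.exp x * Real.exp (-t) * v (x - t) = u (x - t) := by
          rw [hv]; simp only; rw [← mul_assoc, ← Real.exp_add, ← Real.exp_add]; ring_nf; simp
        linear_combination (Real.exp (-t) * t ^ (-1 - α)) * a1 - t ^ (-1 - α) * a2
      rw [mul_left_comm, ← integral_const_mul]
      simp only [e1]
      rw [integral_sub e0 e2, integral_mul_const, mul_sub, marchaud, ← hc, ← mul_assoc, hc,
        marchaud_exp hα0 hα1, one_mul]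
    linarith
  · exact Eventually.of_forall fun y => Measurable.aestronglyMeasurable (by
      rw [hHf]; fun_prop)
  · refine integrableOn_mul_rpow hα0 hα1 (F := fun t => Real.exp (-t) * (E x - E (x - t)))
      (L := L') (B := 2 * B * Real.exp (1 - x)) (Continuous.aestronglyMeasurable (by fun_prop))
      (fun t h0 h1 => ?_) (fun t h1 => ?_)
    · have h2 := hL' (x - t) ⟨by linarith, by linarith⟩ x ⟨by linarith, by linarith⟩
      rw [sub_sub_cancel, abs_of_pos h0] at h2
      rw [abs_mul, abs_of_pos (Real.exp_pos _)]
      calc _ ≤ 1 * (L' * t) := by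
            gcongr
            exact Real.exp_le_one_iff.2 (by linarith)
        _ = _ := one_mul _
    · rw [hJ, abs_mul, abs_of_pos (Real.exp_pos _)]
      have h2 : |∫ s in (0 : ℝ)..t, Real.exp (-(t - s)) * u (x - s)|
          ≤ ∫ s in (0 : ℝ)..t, Real.exp (-(t - s)) * B := by
        rw [← Real.norm_eq_abs]
        refine intervalIntegral.norm_integral_le_of_norm_le (by linarith)
          (ae_of_all _ fun s hs => ?_) ?_
        swap
        · exact Continuous.intervalIntegrable (by fun_prop) _ _
        rw [Real.norm_eq_abs, abs_mul, abs_of_pos (Real.exp_pos _)]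
        exact mul_le_mul_of_nonneg_left (hB _ (by linarith [hs.1])) (Real.exp_pos _).le
      rw [intervalIntegral.integral_mul_const, integral_exp_sub] at h2
      have h3 : (1 - Real.exp (-t)) * B ≤ 2 * B := by nlinarith [Real.exp_pos (-t)]
      rw [mul_comm]
      gcongr
      · exact h2.trans h3
      · linarith
  · exact Measurable.aestronglyMeasurable (by fun_prop)
  · refine (ae_restrict_iff' measurableSet_Ioi).2 (ae_of_all _ fun t ht y hy => ?_)
    have ht : 0 < t := ht
    rw [norm_mul, Real.norm_eq_abs, Real.norm_eq_abs, abs_of_nonneg (Real.rpow_nonneg ht.le _)]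
    gcongr
    split_ifs with h1
    · rw [Metric.mem_ball, Real.dist_eq, abs_lt] at hy
      have h2 := hL (y - t) ⟨by linarith, by linarith⟩ y ⟨by linarith, by linarith⟩
      rw [sub_sub_cancel, abs_of_pos ht] at h2
      rw [abs_mul, abs_of_pos (Real.exp_pos _)]
      calc _ ≤ 1 * (L * t) := by
            gcongr
            exact Real.exp_le_one_iff.2 (by linarith)
        _ = _ := one_mul _
    · exact hvB y hy t ht
  · refine integrableOn_mul_rpow hα0 hα1 (L := L) (B := 2 * B * Real.exp (1 - x))
      (Measurable.aestronglyMeasurable (Measurable.ite measurableSet_Iic (by fun_prop) (by fun_prop)))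
      (fun t h0 h1 => ?_) (fun t h1 => ?_)
    · rw [if_pos h1, abs_of_nonneg (by positivity)]
    · rw [if_neg (not_le.2 h1), abs_of_nonneg (by positivity)]
  · refine ae_of_all _ fun t y _ => ?_
    have h1 : HasDerivAt (fun y => E (y - t)) (v (y - t)) y := by
      simpa using (hEd (y - t)).comp_sub_const y t
    exact (((hEd y).sub h1).const_mul _).mul_const _

end LeftTame

/-! ### The left tail -/

theorem le_of_hasDerivAt_nonneg {G G' : ℝ → ℝ} {a b : ℝ} (hab : a ≤ b)
    (hG : ∀ x, HasDerivAt G (G' x) x) (hG' : ∀ x ∈ Icc a b, 0 ≤ G' x) : G a ≤ G b := by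
  have hc : Continuous G := continuous_iff_continuousAt.2 fun x => (hG x).continuousAt
  refine monotoneOn_of_deriv_nonneg (convex_Icc a b) hc.continuousOn
    (fun x _ => (hG x).differentiableAt.differentiableWithinAt) (fun x hx => ?_)
    (left_mem_Icc.2 hab) (right_mem_Icc.2 hab) hab
  rw [(hG x).deriv]
  exact hG' x (interior_subset hx)

theorem hasDerivAt_exp_mul_mul (ν : ℝ) {U : ℝ → ℝ} {U' x : ℝ} (hU : HasDerivAt U U' x) :
    HasDerivAt (fun y => Real.exp (ν * y) * U y) (Real.exp (ν * x) * (ν * U x + U')) x := by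
  have h1 : HasDerivAt (fun y => Real.exp (ν * y)) (Real.exp (ν * x) * ν) x := by
    simpa using ((hasDerivAt_id x).const_mul ν).exp
  refine (h1.mul hU).congr_deriv ?_
  ring

/-- A bounded solution of `dU/dx = U - r` with `r ≥ 0` not eventually zero is positive. -/
theorem pos_of_hasDerivAt_sub {U r : ℝ → ℝ} {B : ℝ} (hU : ∀ x, HasDerivAt U (U x - r x) x)
    (hB : ∀ x, |U x| ≤ B) (hr : ∀ x, 0 ≤ r x) (hpos : ∃ᶠ x in atTop, 0 < r x) (x : ℝ) :
    0 < U x := by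
  have hder : ∀ y, HasDerivAt (fun z => -(Real.exp (-1 * z) * U z)) (Real.exp (-1 * y) * r y) y :=
    fun y => (hasDerivAt_exp_mul_mul (-1) (hU y)).neg.congr_deriv (by ring)
  have hanti : ∀ y z, y ≤ z → Real.exp (-1 * z) * U z ≤ Real.exp (-1 * y) * U y := by
    intro y z hyz
    have := le_of_hasDerivAt_nonneg hyz hder fun w _ => mul_nonneg (Real.exp_pos _).le (hr w)
    exact neg_le_neg_iff.1 this
  have hlim : Tendsto (fun z => Real.exp (-1 * z) * U z) atTop (𝓝 0) := by
    have h1 : Tendsto (fun z : ℝ => Real.exp (-1 * z) * B) atTop (𝓝 0) := by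
      have : Tendsto (fun z : ℝ => Real.exp (-z)) atTop (𝓝 0) :=
        Real.tendsto_exp_neg_atTop_nhds_zero
      simpa using this.mul_const B
    refine squeeze_zero_norm (fun z => ?_) h1
    rw [norm_mul, Real.norm_eq_abs, Real.norm_eq_abs, abs_of_pos (Real.exp_pos _)]
    exact mul_le_mul_of_nonneg_left (hB z) (Real.exp_pos _).le
  have hnn : ∀ y, 0 ≤ U y := by
    intro y
    have : 0 ≤ Real.exp (-1 * y) * U y :=
      le_of_tendsto hlim ((eventually_ge_atTop y).mono fun z hz => hanti y z hz)
    exact nonneg_of_mul_nonneg_right this (Real.exp_pos _)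
  by_contra hcon
  have hx0 : U x = 0 := le_antisymm (not_lt.1 hcon) (hnn x)
  -- A zero of `U` propagates to the right, where the equation then forces `r = 0`.
  have hz : ∀ y, x ≤ y → U y = 0 := fun y hy => by
    have h1 := hanti x y hy
    rw [hx0, mul_zero] at h1
    have h2 : U y ≤ 0 := by
      by_contra h3
      exact absurd h1 (not_le.2 (mul_pos (Real.exp_pos _) (not_le.1 h3)))
    exact le_antisymm h2 (hnn y)
  obtain ⟨y, hy1, hy2⟩ := (hpos.and_eventually (eventually_gt_atTop x)).exists
  have h1 : HasDerivAt U 0 y := by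
    refine (hasDerivAt_const y (0 : ℝ)).congr_of_eventuallyEq ?_
    filter_upwards [lt_mem_nhds hy2] with z hz' using hz z hz'.le
  have h2 := h1.unique (hU y)
  rw [hz y hy2.le] at h2
  linarith

theorem abs_kconv_le {α : ℝ} (hα0 : 0 < α) (hα1 : α < 1) {u : ℝ → ℝ}
    {B x : ℝ} (hB : ∀ y ≤ x, |u y| ≤ B) : |kconv α u x| ≤ B := by
  have h1 : ‖∫ s in Ioi (0 : ℝ), kernel α s * u (x - s)‖ ≤ ∫ s in Ioi (0 : ℝ), kernel α s * B := by
    refine norm_integral_le_of_norm_le ((integrableOn_kernel hα0 hα1).mul_const B) ?_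
    refine (ae_restrict_iff' measurableSet_Ioi).2 (ae_of_all _ fun s hs => ?_)
    have hs : 0 < s := hs
    rw [norm_mul, Real.norm_eq_abs, Real.norm_eq_abs, abs_of_pos (kernel_pos hα0 hα1 hs)]
    exact mul_le_mul_of_nonneg_left (hB _ (by linarith)) (kernel_pos hα0 hα1 hs).le
  rwa [integral_mul_const, integral_kernel hα0 hα1, one_mul] at h1

/-- Up to a small multiple of the supremum, the kernel integral of a nonnegative function is
controlled by its weight integral. -/
theorem exists_kernel_integral_le {α : ℝ} (hα0 : 0 < α) (hα1 : α < 1) :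
    ∃ C, 0 < C ∧ ∀ (q : ℝ → ℝ) (Q : ℝ), (∀ s, 0 < s → 0 ≤ q s) → (∀ s, 0 < s → q s ≤ Q) →
      IntegrableOn (fun s => kernel α s * q s) (Ioi 0) →
      IntegrableOn (fun s => q s * weight α s) (Ioi 0) →
      ∫ s in Ioi (0 : ℝ), kernel α s * q s
        ≤ C * (∫ s in Ioi (0 : ℝ), q s * weight α s) + Q / 4 := by
  have hk := integrableOn_kernel hα0 hα1
  have hlim := intervalIntegral_tendsto_integral_Ioi 0 hk tendsto_id
  rw [integral_kernel hα0 hα1] at hlim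
  -- Beyond `R` the kernel has mass below `1/4`; up to `R` it is at most `e (R + 1)` times the
  -- weight.
  obtain ⟨R, hR0, hR⟩ := ((eventually_gt_atTop (0 : ℝ)).and
    (hlim.eventually (eventually_gt_nhds (show (3 / 4 : ℝ) < 1 by norm_num)))).exists
  simp only [id] at hR
  rw [intervalIntegral.integral_of_le hR0.le] at hR
  have hsplit := setIntegral_union (Ioc_disjoint_Ioi (le_refl R) (a := 0)) measurableSet_Ioi
    (hk.mono_set Ioc_subset_Ioi_self) (hk.mono_set (Ioi_subset_Ioi hR0.le))
  rw [Ioc_union_Ioi_eq_Ioi hR0.le, integral_kernel hα0 hα1] at hsplit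
  refine ⟨Real.exp 1 * (R + 1), by positivity, fun q Q hq0 hqQ hi1 hi2 => ?_⟩
  have hQ : 0 ≤ Q := (hq0 1 one_pos).trans (hqQ 1 one_pos)
  have hi3 : IntegrableOn (fun s => (Ioi R).indicator (kernel α) s * Q) (Ioi 0) :=
    (Integrable.indicator hk measurableSet_Ioi).mul_const Q
  have hle : ∫ s in Ioi (0 : ℝ), kernel α s * q s ≤
      ∫ s in Ioi (0 : ℝ), (Real.exp 1 * (R + 1) * (q s * weight α s)
        + (Ioi R).indicator (kernel α) s * Q) := by
    refine setIntegral_mono_on hi1 ((hi2.const_mul _).add hi3) measurableSet_Ioi fun s hs => ?_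
    have hs : 0 < s := hs
    have hk0 := kernel_pos hα0 hα1 hs
    have hw0 := weight_pos hα0 hα1 hs
    have hq := hq0 s hs
    by_cases hsR : s ∈ Ioi R
    · rw [indicator_of_mem hsR]
      have h1 : kernel α s * q s ≤ kernel α s * Q :=
        mul_le_mul_of_nonneg_left (hqQ s hs) hk0.le
      have h2 : 0 ≤ Real.exp 1 * (R + 1) * (q s * weight α s) := by positivity
      linarith
    · rw [indicator_of_notMem hsR, zero_mul, add_zero]
      have hsR : s ≤ R := not_lt.1 hsR
      have h1 := kernel_le_weight hα0 hα1 hs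
      have h2 : kernel α s ≤ Real.exp 1 * (R + 1) * weight α s := by
        refine h1.trans ?_
        gcongr
      calc kernel α s * q s ≤ Real.exp 1 * (R + 1) * weight α s * q s := by gcongr
        _ = _ := by ring
  rw [integral_add (hi2.const_mul _) hi3, integral_const_mul, integral_mul_const,
    setIntegral_indicator measurableSet_Ioi, inter_eq_right.2 (Ioi_subset_Ioi hR0.le)] at hle
  nlinarith

/-- At points where `|u|` exceeds all its earlier values, `|u|` is controlled by `k * u`. -/
theorem exists_record_bound {α : ℝ} (hα0 : 0 < α) (hα1 : α < 1) {u r : ℝ → ℝ} {K : ℝ}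
    (hu : LeftTame u) (heq : ∀ x, marchaud α u x = u x - r x) (hr0 : ∀ x, 0 ≤ r x) (hK : 0 < K)
    (hrK : ∀ x, |u x| ≤ 1 → r x ≤ K * u x ^ 2) (hU : ∀ x, 0 < kconv α u x) :
    ∃ C p, 0 < C ∧ 0 < p ∧ p ≤ 1 ∧ ∀ x, (∀ y ≤ x, |u y| ≤ |u x|) → |u x| ≤ p →
      |u x| ≤ C * kconv α u x := by
  obtain ⟨C, hC0, hC⟩ := exists_kernel_integral_le hα0 hα1
  refine ⟨2 * (1 + C), min 1 (1 / (4 * C * K)), by positivity, by positivity, min_le_left _ _,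
    fun x hx hp => ?_⟩
  have hp1 : |u x| ≤ 1 := hp.trans (min_le_left _ _)
  have hp2 : |u x| * (4 * C * K) ≤ 1 := by
    rw [← le_div_iff₀ (by positivity)]; exact hp.trans (min_le_right _ _)
  have hr := hrK x hp1
  have hr0 := hr0 x
  have hUx := hU x
  have hi1 := hu.integrableOn_kernel_sub hα0 hα1 x
  have he1 := hu.integral_kernel_sub hα0 hα1 x
  obtain ⟨hi2, he2⟩ := hu.weight_identity hα0 hα1 x
  rw [heq] at he2
  rcases le_total 0 (u x) with hs | hs
  · rw [abs_of_nonneg hs] at hx ⊢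
    have h1 := hC (fun s => u x - u (x - s)) (2 * u x)
      (fun s hs' => by linarith [(abs_le.1 (hx (x - s) (by linarith))).2])
      (fun s hs' => by linarith [(abs_le.1 (hx (x - s) (by linarith))).1]) hi1 hi2
    rw [he1, he2] at h1
    -- The estimate reads `u - U ≤ C (U - r) + u / 2` with `U = k * u`; half of `u` is absorbed on
    -- the left.
    have : 0 ≤ C * r x := by positivity
    nlinarith
  · rw [abs_of_nonpos hs] at hx hp2 ⊢
    have hi1' : IntegrableOn (fun s => kernel α s * (u (x - s) - u x)) (Ioi 0) := by
      refine hi1.neg.congr (ae_of_all _ fun s => ?_)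
      simp only [Pi.neg_apply]; ring
    have hi2' : IntegrableOn (fun s => (u (x - s) - u x) * weight α s) (Ioi 0) := by
      refine hi2.neg.congr (ae_of_all _ fun s => ?_)
      simp only [Pi.neg_apply]; ring
    have h1 := hC (fun s => u (x - s) - u x) (2 * -u x)
      (fun s hs' => by linarith [(abs_le.1 (hx (x - s) (by linarith))).1])
      (fun s hs' => by linarith [(abs_le.1 (hx (x - s) (by linarith))).2]) hi1' hi2'
    have e1 : ∫ s in Ioi (0 : ℝ), kernel α s * (u (x - s) - u x) = -(u x - kconv α u x) := by
      rw [← he1, ← integral_neg]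
      congr 1; ext s; ring
    have e2 : ∫ s in Ioi (0 : ℝ), (u (x - s) - u x) * weight α s
        = -(u x - r x - u x + kconv α u x) := by
      rw [← he2, ← integral_neg]
      congr 1; ext s; ring
    rw [e1, e2] at h1
    have h2 : C * r x ≤ C * (K * u x ^ 2) := by gcongr
    have h3 : C * (K * u x ^ 2) ≤ -u x / 4 := by nlinarith
    have h4 : 0 < C * kconv α u x := by positivity
    -- For a negative record, `|u| + U ≤ C (r - U) + |u| / 2` while `C r ≤ |u| / 4`: this is
    -- contradictory because `U > 0`, so the case does not occur.
    nlinarith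

/-! ### The weight operator and the expansion at `-∞`. -/

/-- Maximum principle for the weight operator on left half-lines. -/
theorem nonpos_of_weight_integral_nonpos {α : ℝ} (hα0 : 0 < α) (hα1 : α < 1) {g : ℝ → ℝ}
    (hg : LeftTame g) (hlim : Tendsto g atBot (𝓝 0)) {a : ℝ}
    (hle : ∀ x ≤ a, ∫ s in Ioi (0 : ℝ), (g x - g (x - s)) * weight α s ≤ 0) :
    ∀ x ≤ a, g x ≤ 0 := by
  intro x hx
  by_contra hcon
  obtain ⟨x', hx', hge, hmax⟩ := exists_max_past hg.continuous hlim (not_le.1 hcon)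
  have hpos : 0 < g x' := (not_le.1 hcon).trans_le hge
  obtain ⟨y, hy, hlt⟩ := exists_lt_past hlim hpos
  have := integral_past_pos (fun s hs => weight_pos hα0 hα1 hs) hg.continuous
    (hg.weight_identity hα0 hα1 x').1 (fun y hy => hmax y (hy.trans hx')) hy hlt
  exact absurd (hle x' (hx'.trans hx)) (not_le.2 this)

theorem weight_integral_sub {α : ℝ} (hα0 : 0 < α) (hα1 : α < 1) {g₁ g₂ : ℝ → ℝ}
    (h₁ : LeftTame g₁) (h₂ : LeftTame g₂) (x : ℝ) :
    ∫ s in Ioi (0 : ℝ), ((g₁ x - g₂ x) - (g₁ (x - s) - g₂ (x - s))) * weight α s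
      = (∫ s in Ioi (0 : ℝ), (g₁ x - g₁ (x - s)) * weight α s)
        - ∫ s in Ioi (0 : ℝ), (g₂ x - g₂ (x - s)) * weight α s := by
  rw [← integral_sub (h₁.weight_identity hα0 hα1 x).1 (h₂.weight_identity hα0 hα1 x).1]
  congr 1; ext s; ring

theorem weight_integral_const_mul (α b : ℝ) (g : ℝ → ℝ) (x : ℝ) :
    ∫ s in Ioi (0 : ℝ), (b * g x - b * g (x - s)) * weight α s
      = b * ∫ s in Ioi (0 : ℝ), (g x - g (x - s)) * weight α s := by
  rw [← integral_const_mul]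
  congr 1; ext s; ring

/-- The operator commutes with translations, which only rescale exponentials; the eigenvalue is its
value at `0`, positive by the strict maximum principle. -/
theorem weight_integral_exp {α : ℝ} (hα0 : 0 < α) (hα1 : α < 1) {ν : ℝ} (hν : 0 < ν) :
    ∃ m, 0 < m ∧ ∀ x, ∫ s in Ioi (0 : ℝ),
      (Real.exp (ν * x) - Real.exp (ν * (x - s))) * weight α s = m * Real.exp (ν * x) := by
  have ht := LeftTame.exp_mul hν
  refine ⟨∫ s in Ioi (0 : ℝ), (Real.exp (ν * 0) - Real.exp (ν * (0 - s))) * weight α s, ?_,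
    fun x => ?_⟩
  · exact integral_past_pos (g := fun x => Real.exp (ν * x)) (x := 0) (y := -1)
      (fun s hs => weight_pos hα0 hα1 hs) ht.continuous
      (ht.weight_identity hα0 hα1 0).1 (fun y hy => Real.exp_le_exp.2 (by gcongr))
      (by norm_num) (Real.exp_lt_exp.2 (by linarith))
  · rw [← integral_mul_const]
    congr 1; ext s
    rw [show ν * (x - s) = ν * (0 - s) + ν * x by ring, Real.exp_add]
    simp; ring

/-- Exact exponential behaviour at `-∞`. -/
theorem exists_left_asymptotics {α : ℝ} (hα0 : 0 < α) (hα1 : α < 1) {u r : ℝ → ℝ} {B K : ℝ}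
    (hu : ContDiff ℝ 1 u) (hB : ∀ x, |u x| ≤ B) (hbot : Tendsto u atBot (𝓝 0))
    (heq : ∀ x, marchaud α u x = u x - r x) (hr0 : ∀ x, 0 ≤ r x) (hK : 0 < K)
    (hrK : ∀ x, |u x| ≤ 1 → r x ≤ K * u x ^ 2) (hpos : ∃ᶠ x in atTop, 0 < r x) :
    ∃ A, 0 < A ∧ ∃ D a, ∀ x ≤ a, |u x - A * Real.exp x| ≤ D * Real.exp (3 / 2 * x) := by
  have ht : LeftTame u := LeftTame.of_bounded hu hB
  set U := kconv α u with hUdef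
  have hUd : ∀ x, HasDerivAt U (U x - r x) x := fun x =>
    (ht.hasDerivAt_kconv hα0 hα1 x).congr_deriv (by rw [heq]; ring)
  have hU0 : ∀ x, 0 < U x := pos_of_hasDerivAt_sub hUd
    (fun x => abs_kconv_le hα0 hα1 fun y _ => hB y) hr0 hpos
  obtain ⟨C, p, hC0, hp0, hp1, hrec⟩ := exists_record_bound hα0 hα1 ht heq hr0 hK hrK hU0
  -- This smallness turns `r ≤ K u²` into `r ≤ K p' |u|`, hence into `r ≤ U / 4` once `|u| ≤ C U` is
  -- known.
  set p' := min p (1 / (4 * K * C)) with hp'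
  have hp'0 : 0 < p' := by positivity
  have hp'K : K * p' * C ≤ 1 / 4 := by
    have : p' ≤ 1 / (4 * K * C) := min_le_right _ _
    rw [le_div_iff₀ (by positivity)] at this
    linarith
  have habs : Tendsto (fun x => |u x|) atBot (𝓝 0) := by simpa using hbot.abs
  obtain ⟨a, ha⟩ := eventually_atBot.1 (habs.eventually (eventually_le_nhds hp'0))
  have hru : ∀ x ≤ a, r x ≤ K * p' * |u x| := fun x hx => by
    have h1 := hrK x ((ha x hx).trans ((min_le_left _ _).trans hp1))
    have h2 : K * u x ^ 2 ≤ K * p' * |u x| := by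
      rw [← sq_abs, sq, ← mul_assoc]
      gcongr
      exact ha x hx
    exact h1.trans h2
  -- From records to all points: at the past maximum `x'` of `|u|`, with value `P`, one has `U ≥ P /
  -- C`. This persists up to `x`, because there `r ≤ P / C` and `(U - P / C)' = U - r`.
  have hbd : ∀ x ≤ a, |u x| ≤ C * U x := by
    intro x hx
    rcases (abs_nonneg (u x)).eq_or_lt with h0 | h0
    · rw [← h0]; have := hU0 x; positivity
    obtain ⟨x', hx', hge, hmax⟩ := exists_max_past (g := fun x => |u x|) ht.continuous.abs habs h0
    have h1 := hrec x' (fun y hy => hmax y (hy.trans hx'))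
      ((ha x' (hx'.trans hx)).trans (min_le_left _ _))
    set P := |u x'| with hP
    have hP0 : 0 < P := h0.trans_le hge
    have hder : ∀ y, HasDerivAt (fun z => Real.exp (-1 * z) * (U z - P / C))
        (Real.exp (-1 * y) * (-1 * (U y - P / C) + (U y - r y))) y := fun y =>
      hasDerivAt_exp_mul_mul (-1) ((hUd y).sub_const (P / C))
    have h2 := le_of_hasDerivAt_nonneg hx' hder fun y hy => by
      refine mul_nonneg (Real.exp_pos _).le ?_
      have h3 := hru y (hy.2.trans hx)
      have h4 : K * p' * |u y| ≤ K * p' * P := by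
        gcongr
        exact hmax y hy.2
      have h5 : K * p' * P ≤ P / C := by
        rw [le_div_iff₀ hC0]
        nlinarith
      linarith
    have h6 : 0 ≤ U x' - P / C := by
      rw [sub_nonneg, div_le_iff₀ hC0]
      linarith
    have h7 : 0 ≤ Real.exp (-1 * x) * (U x - P / C) :=
      (mul_nonneg (Real.exp_pos _).le h6).trans h2
    have h8 := nonneg_of_mul_nonneg_right h7 (Real.exp_pos _)
    rw [sub_nonneg, div_le_iff₀ hC0] at h8
    linarith
  have hrU : ∀ x ≤ a, r x ≤ U x / 4 := fun x hx => by
    have h1 := hru x hx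
    have h2 : K * p' * |u x| ≤ K * p' * (C * U x) := by
      gcongr
      exact hbd x hx
    nlinarith [hU0 x]
  set C₂ := Real.exp (-(3 / 4) * a) * U a with hC₂
  have hC₂0 : 0 < C₂ := mul_pos (Real.exp_pos _) (hU0 a)
  -- Now `U' ≥ (3/4) U`, a non-sharp exponential rate. Squaring it in `r ≤ K u²` gives `e^(3x/2)`,
  -- already smaller than `e^x`.
  have hUle : ∀ x ≤ a, U x ≤ C₂ * Real.exp (3 / 4 * x) := by
    intro x hx
    have h1 := le_of_hasDerivAt_nonneg hx
      (fun y => hasDerivAt_exp_mul_mul (-(3 / 4)) (hUd y)) fun y hy => by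
        refine mul_nonneg (Real.exp_pos _).le ?_
        have := hrU y hy.2
        linarith
    rw [← hC₂] at h1
    have h2 := mul_le_mul_of_nonneg_right h1 (Real.exp_pos (3 / 4 * x)).le
    have h3 : Real.exp (-(3 / 4) * x) * Real.exp (3 / 4 * x) = 1 := by
      rw [← Real.exp_add]; simp
    calc U x = Real.exp (-(3 / 4) * x) * U x * Real.exp (3 / 4 * x) := by
          rw [mul_right_comm, h3, one_mul]
      _ ≤ _ := h2
  set C₃ := K * (C * C₂) ^ 2 with hC₃
  have hC₃0 : 0 < C₃ := by positivity
  have hrle : ∀ x ≤ a, r x ≤ C₃ * Real.exp (3 / 2 * x) := by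
    intro x hx
    have h1 := hrK x ((ha x hx).trans ((min_le_left _ _).trans hp1))
    have h2 : |u x| ≤ C * C₂ * Real.exp (3 / 4 * x) := (hbd x hx).trans (by
      rw [mul_assoc]
      gcongr
      exact hUle x hx)
    have h3 : u x ^ 2 ≤ (C * C₂ * Real.exp (3 / 4 * x)) ^ 2 := by
      rw [← sq_abs]
      gcongr
    have h4 : Real.exp (3 / 2 * x) = Real.exp (3 / 4 * x) ^ 2 := by
      rw [← Real.exp_nat_mul]; push_cast; ring_nf
    calc r x ≤ K * u x ^ 2 := h1
      _ ≤ K * (C * C₂ * Real.exp (3 / 4 * x)) ^ 2 := by gcongr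
      _ = _ := by rw [h4, hC₃]; ring
  -- `G' = -e^(-x) r` lies between `-C₃ e^(x/2)` and `0` on the left half-line, so `G` increases to
  -- a finite limit `A` towards `-∞`, with error `2 C₃ e^(x/2)`.
  set G : ℝ → ℝ := fun x => Real.exp (-1 * x) * U x with hG
  have hGd : ∀ x, HasDerivAt G (Real.exp (-1 * x) * (-1 * U x + (U x - r x))) x := fun x =>
    hasDerivAt_exp_mul_mul (-1) (hUd x)
  have hGanti : Antitone G := fun x y hxy => by
    have := le_of_hasDerivAt_nonneg hxy (fun z => (hGd z).neg) fun z _ => by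
      have := mul_nonneg (Real.exp_pos (-1 * z)).le (hr0 z)
      linarith
    exact neg_le_neg_iff.1 this
  have hGup : ∀ x y, x ≤ y → y ≤ a →
      G x + 2 * C₃ * Real.exp (1 / 2 * x) ≤ G y + 2 * C₃ * Real.exp (1 / 2 * y) := by
    intro x y hxy hya
    have hd : ∀ z, HasDerivAt (fun x => 2 * C₃ * Real.exp (1 / 2 * x))
        (C₃ * Real.exp (1 / 2 * z)) z := fun z => by
      have h1 : HasDerivAt (fun y => Real.exp (1 / 2 * y)) (Real.exp (1 / 2 * z) * (1 / 2)) z := by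
        simpa only [id, mul_one] using ((hasDerivAt_id z).const_mul (1 / 2)).exp
      exact (h1.const_mul (2 * C₃)).congr_deriv (by ring)
    refine le_of_hasDerivAt_nonneg hxy (fun z => (hGd z).add (hd z)) fun z hz => ?_
    have h1 := mul_le_mul_of_nonneg_left (hrle z (hz.2.trans hya)) (Real.exp_pos (-1 * z)).le
    have h2 : Real.exp (-1 * z) * Real.exp (3 / 2 * z) = Real.exp (1 / 2 * z) := by
      rw [← Real.exp_add]; ring_nf
    have h3 : Real.exp (-1 * z) * (C₃ * Real.exp (3 / 2 * z)) = C₃ * Real.exp (1 / 2 * z) := by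
      rw [← h2]; ring
    linarith
  have hbdd : BddAbove (range G) := by
    refine ⟨G a + 2 * C₃ * Real.exp (1 / 2 * a), ?_⟩
    rintro _ ⟨x, rfl⟩
    have e1 : 0 ≤ 2 * C₃ * Real.exp (1 / 2 * a) := by positivity
    have e2 : 0 ≤ 2 * C₃ * Real.exp (1 / 2 * x) := by positivity
    rcases le_total x a with hxa | hxa
    · have := hGup x a hxa le_rfl
      linarith
    · have := hGanti hxa
      linarith
  set A := ⨆ x, G x with hA
  have hGA : ∀ x, G x ≤ A := fun x => le_ciSup hbdd x
  have hA0 : 0 < A := (mul_pos (Real.exp_pos _) (hU0 a)).trans_le (hGA a)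
  have hAG : ∀ x ≤ a, A ≤ G x + 2 * C₃ * Real.exp (1 / 2 * x) := fun x hx => by
    refine ciSup_le fun y => ?_
    have e2 : 0 ≤ 2 * C₃ * Real.exp (1 / 2 * x) := by positivity
    have e1 : 0 ≤ 2 * C₃ * Real.exp (1 / 2 * y) := by positivity
    rcases le_total y x with hxy | hxy
    · have := hGup y x hxy hx
      linarith
    · have := hGanti hxy
      linarith
  have hUG : ∀ x, U x = Real.exp x * G x := fun x => by
    rw [hG]; simp only; rw [← mul_assoc, ← Real.exp_add]; simp
  have hUA : ∀ x ≤ a, |U x - A * Real.exp x| ≤ 2 * C₃ * Real.exp (3 / 2 * x) := fun x hx => by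
    have h2 : Real.exp x * Real.exp (1 / 2 * x) = Real.exp (3 / 2 * x) := by
      rw [← Real.exp_add]; ring_nf
    have h3 := mul_le_mul_of_nonneg_left (hAG x hx) (Real.exp_pos x).le
    have h4 := mul_le_mul_of_nonneg_left (hGA x) (Real.exp_pos x).le
    have h5 : Real.exp x * (2 * C₃ * Real.exp (1 / 2 * x)) = 2 * C₃ * Real.exp (3 / 2 * x) := by
      rw [← h2]; ring
    have h6 : 0 ≤ 2 * C₃ * Real.exp (3 / 2 * x) := by positivity
    rw [hUG, abs_le]
    constructor <;> linarith
  -- The weight operator maps `u` to `U - r = A e^x + O(e^(3x/2))`. Dividing by its eigenvalue on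
  -- `e^x` gives the leading term of `u`, and the eigenfunction `e^(3x/2)` is a barrier for the
  -- rest.
  obtain ⟨κ, hκ0, hκ⟩ := weight_integral_exp hα0 hα1 one_pos
  obtain ⟨m, hm0, hm⟩ := weight_integral_exp hα0 hα1 (show (0 : ℝ) < 3 / 2 by norm_num)
  simp only [one_mul] at hκ
  have hte : LeftTame Real.exp := by simpa using LeftTame.exp_mul one_pos
  have ht3 := LeftTame.exp_mul (show (0 : ℝ) < 3 / 2 by norm_num)
  have htv := ht.sub (hte.const_mul (A / κ))
  set v : ℝ → ℝ := fun x => u x - A / κ * Real.exp x with hv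
  have hvM : ∀ x ≤ a, |∫ s in Ioi (0 : ℝ), (v x - v (x - s)) * weight α s|
      ≤ 3 * C₃ * Real.exp (3 / 2 * x) := by
    intro x hx
    have h1 := weight_integral_sub hα0 hα1 ht (hte.const_mul (A / κ)) x
    rw [weight_integral_const_mul, hκ, (ht.weight_identity hα0 hα1 x).2, heq,
      ← mul_assoc, div_mul_cancel₀ _ hκ0.ne'] at h1
    rw [hv]
    simp only
    rw [h1, ← hUdef]
    have h2 := hUA x hx
    have h3 := hrle x hx
    have h4 := hr0 x
    rw [abs_le] at h2 ⊢
    constructor <;> linarith [h2.1, h2.2]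
  have hvlim : Tendsto v atBot (𝓝 0) := by
    have := hbot.sub (Real.tendsto_exp_atBot.const_mul (A / κ))
    simpa using this
  have h3lim : Tendsto (fun x : ℝ => 3 * C₃ / m * Real.exp (3 / 2 * x)) atBot (𝓝 0) := by
    have h1 : Tendsto (fun x : ℝ => 3 / 2 * x) atBot atBot :=
      tendsto_id.const_mul_atBot (by norm_num)
    have := (Real.tendsto_exp_atBot.comp h1).const_mul (3 * C₃ / m)
    simpa using this
  have hmain : ∀ σ : ℝ, |σ| = 1 → ∀ x ≤ a, σ * v x - 3 * C₃ / m * Real.exp (3 / 2 * x) ≤ 0 := by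
    intro σ hσ
    refine nonpos_of_weight_integral_nonpos hα0 hα1
      ((htv.const_mul σ).sub (ht3.const_mul (3 * C₃ / m))) ?_ fun x hx => ?_
    · simpa using (hvlim.const_mul σ).sub h3lim
    · rw [weight_integral_sub hα0 hα1 (htv.const_mul σ) (ht3.const_mul (3 * C₃ / m)),
        weight_integral_const_mul, weight_integral_const_mul α _ (fun x => Real.exp (3 / 2 * x)),
        hm, ← mul_assoc, div_mul_cancel₀ _ hm0.ne', sub_nonpos]
      refine (le_abs_self _).trans ?_
      rw [abs_mul, hσ, one_mul]
      exact hvM x hx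
  refine ⟨A / κ, by positivity, 3 * C₃ / m, a, fun x hx => ?_⟩
  have h1 := hmain 1 (by simp) x hx
  have h2 := hmain (-1) (by simp) x hx
  simp only [hv] at h1 h2
  rw [abs_le]
  constructor <;> linarith

/-! ### Normalised profiles: comparison, monotonicity, uniqueness -/

/-- Solutions of `𝒟^α ψ = H(ψ)` connecting `φm` to `φp`. -/
structure IsProfile (α : ℝ) (H : ℝ → ℝ) (φm φp : ℝ) (ψ : ℝ → ℝ) : Prop where
  contDiff : ContDiff ℝ 1 ψ
  equation : ∀ x, marchaud α ψ x = H (ψ x)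
  tendsto_atBot : Tendsto ψ atBot (𝓝 φm)
  tendsto_atTop : Tendsto ψ atTop (𝓝 φp)

/-- Convex nonlinearities vanishing at both end states, with slope `1` at the left one. -/
structure IsNormalized (H : ℝ → ℝ) (φm φp : ℝ) : Prop where
  contDiff : ContDiff ℝ 2 H
  convex : ConvexOn ℝ univ H
  lt : φp < φm
  left_zero : H φm = 0
  right_zero : H φp = 0
  deriv_left : deriv H φm = 1

theorem exists_bound_of_tendsto {g : ℝ → ℝ} (hg : Continuous g) {l₁ l₂ : ℝ}
    (h₁ : Tendsto g atBot (𝓝 l₁)) (h₂ : Tendsto g atTop (𝓝 l₂)) : ∃ B, ∀ x, |g x| ≤ B := by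
  obtain ⟨a, ha⟩ := eventually_atBot.1 (h₁.abs.eventually (eventually_lt_nhds (lt_add_one |l₁|)))
  obtain ⟨b, hb⟩ := eventually_atTop.1 (h₂.abs.eventually (eventually_lt_nhds (lt_add_one |l₂|)))
  obtain ⟨C, hC⟩ := (isCompact_Icc (a := a) (b := b)).exists_bound_of_continuousOn hg.continuousOn
  refine ⟨max C (max (|l₁| + 1) (|l₂| + 1)), fun x => ?_⟩
  rcases le_total x a with h | h
  · exact (ha x h).le.trans ((le_max_left _ _).trans (le_max_right _ _))
  rcases le_total b x with h' | h'
  · exact (hb x h').le.trans ((le_max_right _ _).trans (le_max_right _ _))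
  · exact (hC x ⟨h, h'⟩).trans (le_max_left _ _)

theorem convex_tangent_le {H : ℝ → ℝ} (hH : ConvexOn ℝ univ H) {x d : ℝ} (hd : HasDerivAt H d x)
    (y : ℝ) : H x + d * (y - x) ≤ H y := by
  rcases lt_trichotomy x y with hxy | rfl | hxy
  · have := hH.le_slope_of_hasDerivAt (mem_univ x) (mem_univ y) hxy hd
    rw [slope_def_field, le_div_iff₀ (by linarith)] at this
    linarith
  · simp
  · have := hH.slope_le_of_hasDerivAt (mem_univ y) (mem_univ x) hxy hd
    rw [slope_def_field, div_le_iff₀ (by linarith)] at this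
    linarith

namespace IsNormalized

variable {H : ℝ → ℝ} {φm φp : ℝ}

theorem hasDerivAt (hH : IsNormalized H φm φp) (y : ℝ) : HasDerivAt H (deriv H y) y :=
  (hH.contDiff.differentiable two_ne_zero y).hasDerivAt

theorem sub_le (hH : IsNormalized H φm φp) (y : ℝ) : y - φm ≤ H y := by
  have := convex_tangent_le hH.convex (hH.hasDerivAt φm) y
  rw [hH.left_zero, hH.deriv_left] at this
  linarith

/-- The tangent at `y`, evaluated at `φm`, gives `φm - y + H y ≤ (1 - H'(y)) (φm - y)`, and `H'` is
locally Lipschitz with `H'(φm) = 1`. -/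
theorem exists_quadratic (hH : IsNormalized H φm φp) :
    ∃ K, 0 < K ∧ ∀ y, |φm - y| ≤ 1 → φm - y + H y ≤ K * (φm - y) ^ 2 := by
  have hd : ContDiff ℝ 1 (deriv H) := by
    have := hH.contDiff
    rw [show (2 : WithTop ℕ∞) = 1 + 1 by norm_num, contDiff_succ_iff_deriv] at this
    exact this.2.2
  obtain ⟨L, hL0, hL⟩ := exists_lipschitz_Icc hd (φm - 1) (φm + 1)
  refine ⟨L + 1, by positivity, fun y hy => ?_⟩
  have h1 := convex_tangent_le hH.convex (hH.hasDerivAt y) φm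
  rw [hH.left_zero] at h1
  have hy' := abs_le.1 hy
  have h2 := hL y ⟨by linarith, by linarith⟩ φm ⟨by linarith, by linarith⟩
  rw [hH.deriv_left] at h2
  have h3 : (1 - deriv H y) * (φm - y) ≤ L * |φm - y| * |φm - y| := by
    refine (le_abs_self _).trans ?_
    rw [abs_mul]
    gcongr
  have h4 : |φm - y| * |φm - y| = (φm - y) ^ 2 := by rw [← sq, sq_abs]
  nlinarith [sq_nonneg (φm - y)]

end IsNormalized

namespace IsProfile

variable {α : ℝ} {H : ℝ → ℝ} {φm φp : ℝ} {ψ ψ₁ ψ₂ : ℝ → ℝ}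

theorem exists_bound (hψ : IsProfile α H φm φp ψ) : ∃ B, ∀ x, |ψ x| ≤ B :=
  exists_bound_of_tendsto hψ.contDiff.continuous hψ.tendsto_atBot hψ.tendsto_atTop

theorem leftTame (hψ : IsProfile α H φm φp ψ) : LeftTame ψ :=
  let ⟨_, hB⟩ := hψ.exists_bound
  LeftTame.of_bounded hψ.contDiff hB

theorem shift (hψ : IsProfile α H φm φp ψ) (τ : ℝ) : IsProfile α H φm φp (fun x => ψ (τ + x)) := by
  have hcd := hψ.contDiff
  refine ⟨by fun_prop, fun x => ?_, ?_, ?_⟩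
  · have := marchaud_comp_affine α ψ one_pos τ x
    simp only [one_mul, Real.one_rpow] at this
    rw [this, hψ.equation]
  · exact hψ.tendsto_atBot.comp (tendsto_atBot_add_const_left _ τ tendsto_id)
  · exact hψ.tendsto_atTop.comp (tendsto_atTop_add_const_left _ τ tendsto_id)

/-- The amplitude of the exponential tail at `-∞`. -/
theorem exists_amplitude (hα0 : 0 < α) (hα1 : α < 1) (hH : IsNormalized H φm φp)
    (hψ : IsProfile α H φm φp ψ) :
    ∃ A, 0 < A ∧ Tendsto (fun x => Real.exp (-x) * (φm - ψ x)) atBot (𝓝 A) := by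
  obtain ⟨B, hB⟩ := hψ.exists_bound
  obtain ⟨K, hK0, hK⟩ := hH.exists_quadratic
  have hcd := hψ.contDiff
  -- At `+∞` the remainder tends to `φm - φp > 0`; this is what makes the amplitude strictly
  -- positive.
  have hpos : ∃ᶠ x in atTop, 0 < φm - ψ x + H (ψ x) := by
    refine Eventually.frequently ?_
    have h1 : Tendsto (fun x => φm - ψ x + H (ψ x)) atTop (𝓝 (φm - φp + H φp)) :=
      (hψ.tendsto_atTop.const_sub φm).add
        ((hH.contDiff.continuous.tendsto φp).comp hψ.tendsto_atTop)
    refine h1.eventually (eventually_gt_nhds ?_)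
    rw [hH.right_zero]
    linarith [hH.lt]
  obtain ⟨A, hA0, D, a, hD⟩ := exists_left_asymptotics hα0 hα1 (u := fun x => φm - ψ x)
    (r := fun x => φm - ψ x + H (ψ x)) (B := |φm| + B) (K := K) (by fun_prop)
    (fun x => (abs_sub _ _).trans (by linarith [hB x]))
    (by simpa using hψ.tendsto_atBot.const_sub φm)
    (fun x => by
      rw [(LeftTame.const φm).marchaud_sub hψ.leftTame hα0 hα1, marchaud_const, hψ.equation]; ring)
    (fun x => by linarith [hH.sub_le (ψ x)]) hK0 (fun x hx => hK (ψ x) hx) hpos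
  refine ⟨A, hA0, ?_⟩
  rw [tendsto_iff_norm_sub_tendsto_zero]
  have hlim : Tendsto (fun x : ℝ => D * Real.exp (1 / 2 * x)) atBot (𝓝 0) := by
    have h1 : Tendsto (fun x : ℝ => 1 / 2 * x) atBot atBot :=
      tendsto_id.const_mul_atBot (by norm_num)
    simpa using (Real.tendsto_exp_atBot.comp h1).const_mul D
  refine squeeze_zero' (Eventually.of_forall fun x => norm_nonneg _) ?_ hlim
  filter_upwards [eventually_le_atBot a] with x hx
  have h1 : Real.exp (-x) * (φm - ψ x) - A = Real.exp (-x) * (φm - ψ x - A * Real.exp x) := by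
    have : Real.exp (-x) * Real.exp x = 1 := by rw [← Real.exp_add]; simp
    linear_combination A * this
  have h2 : D * Real.exp (1 / 2 * x) = Real.exp (-x) * (D * Real.exp (3 / 2 * x)) := by
    rw [mul_left_comm, ← Real.exp_add]; ring_nf
  rw [h1, h2, norm_mul, Real.norm_eq_abs, Real.norm_eq_abs, abs_of_pos (Real.exp_pos _)]
  exact mul_le_mul_of_nonneg_left (hD x hx) (Real.exp_pos _).le

/-- Two profiles that are strictly ordered on a left half-line are strictly ordered. -/
theorem lt_of_lt_past (hα0 : 0 < α) (hα1 : α < 1) (h₁ : IsProfile α H φm φp ψ₁)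
    (h₂ : IsProfile α H φm φp ψ₂) {a : ℝ} (ha : ∀ x ≤ a, ψ₁ x < ψ₂ x) (x : ℝ) : ψ₁ x < ψ₂ x := by
  by_contra hcon
  have hc₁ := h₁.contDiff.continuous
  have hc₂ := h₂.contDiff.continuous
  have hax : a < x := by
    by_contra h
    exact hcon (ha x (not_lt.1 h))
  have hcomp : IsCompact (Icc a x ∩ {y | ψ₂ y ≤ ψ₁ y}) :=
    isCompact_Icc.inter_right (isClosed_le hc₂ hc₁)
  obtain ⟨x₀, ⟨hx₀, hle⟩, hleast⟩ := hcomp.exists_isLeast ⟨x, ⟨hax.le, le_rfl⟩, not_lt.1 hcon⟩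
  have hlt : ∀ y < x₀, ψ₁ y < ψ₂ y := by
    intro y hy
    rcases le_total y a with h | h
    · exact ha y h
    · by_contra hy'
      exact absurd (hleast ⟨⟨h, hy.le.trans hx₀.2⟩, not_lt.1 hy'⟩) (not_le.2 hy)
  have hge : ψ₁ x₀ ≤ ψ₂ x₀ := by
    have hcl : x₀ ∈ closure (Iio x₀) := by simp
    exact (closure_minimal (fun y hy => (hlt y hy).le) (isClosed_le hc₁ hc₂)) hcl
  have heq : ψ₁ x₀ = ψ₂ x₀ := le_antisymm hge hle
  -- At the first contact `x₀` the difference is maximal over its past, yet both equations have the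
  -- same right-hand side there.
  have hpos := marchaud_pos_of_max hα0 hα1 (h₁.leftTame.sub h₂.leftTame) (x := x₀) (y := x₀ - 1)
    (fun y hy => by
      rcases hy.eq_or_lt with rfl | hy
      · exact le_rfl
      · linarith [hlt y hy])
    (by linarith) (by linarith [hlt (x₀ - 1) (by linarith)])
  rw [h₁.leftTame.marchaud_sub h₂.leftTame hα0 hα1, h₁.equation, h₂.equation, heq, sub_self] at hpos
  exact lt_irrefl _ hpos

theorem lt_of_amplitude_lt (hα0 : 0 < α) (hα1 : α < 1) (h₁ : IsProfile α H φm φp ψ₁)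
    (h₂ : IsProfile α H φm φp ψ₂) {A₁ A₂ : ℝ}
    (hA₁ : Tendsto (fun x => Real.exp (-x) * (φm - ψ₁ x)) atBot (𝓝 A₁))
    (hA₂ : Tendsto (fun x => Real.exp (-x) * (φm - ψ₂ x)) atBot (𝓝 A₂)) (hA : A₂ < A₁) (x : ℝ) :
    ψ₁ x < ψ₂ x := by
  obtain ⟨a, ha⟩ := eventually_atBot.1 (hA₂.eventually_lt hA₁ hA)
  refine lt_of_lt_past hα0 hα1 h₁ h₂ (a := a) (fun y hy => ?_) x
  have := lt_of_mul_lt_mul_left (ha y hy) (Real.exp_pos _).le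
  linarith

theorem amplitude_shift {A : ℝ} (hA : Tendsto (fun x => Real.exp (-x) * (φm - ψ x)) atBot (𝓝 A))
    (τ : ℝ) :
    Tendsto (fun x => Real.exp (-x) * (φm - ψ (τ + x))) atBot (𝓝 (Real.exp τ * A)) := by
  have := (hA.comp (tendsto_atBot_add_const_left _ τ tendsto_id)).const_mul (Real.exp τ)
  refine this.congr fun x => ?_
  simp only [Function.comp, id]
  rw [← mul_assoc, ← Real.exp_add]
  ring_nf

/-- A shift by `y - x > 0` multiplies the amplitude by `e^(y-x) > 1`, so the shifted profile lies
strictly below the original. -/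
theorem strictAnti (hα0 : 0 < α) (hα1 : α < 1) (hH : IsNormalized H φm φp)
    (hψ : IsProfile α H φm φp ψ) : StrictAnti ψ := by
  intro x y hxy
  obtain ⟨A, hA0, hA⟩ := hψ.exists_amplitude hα0 hα1 hH
  have := lt_of_amplitude_lt hα0 hα1 (hψ.shift (y - x)) hψ (amplitude_shift hA (y - x)) hA
    ((lt_mul_iff_one_lt_left hA0).2 (Real.one_lt_exp_iff.2 (by linarith))) x
  simpa using this

/-- Any shift `τ > 0` of `ψ₁` makes the amplitudes strictly ordered; then `τ → 0⁺`. -/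
theorem le_of_amplitude_eq (hα0 : 0 < α) (hα1 : α < 1) (h₁ : IsProfile α H φm φp ψ₁)
    (h₂ : IsProfile α H φm φp ψ₂) {A : ℝ} (hA0 : 0 < A)
    (hA₁ : Tendsto (fun x => Real.exp (-x) * (φm - ψ₁ x)) atBot (𝓝 A))
    (hA₂ : Tendsto (fun x => Real.exp (-x) * (φm - ψ₂ x)) atBot (𝓝 A)) (x : ℝ) :
    ψ₁ x ≤ ψ₂ x := by
  have h1 : ∀ τ, 0 < τ → ψ₁ (τ + x) < ψ₂ x := fun τ hτ =>
    lt_of_amplitude_lt hα0 hα1 (h₁.shift τ) h₂ (amplitude_shift hA₁ τ) hA₂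
      ((lt_mul_iff_one_lt_left hA0).2 (Real.one_lt_exp_iff.2 hτ)) x
  have hc := h₁.contDiff.continuous
  have h2 : Tendsto (fun τ => ψ₁ (τ + x)) (𝓝[>] 0) (𝓝 (ψ₁ x)) := by
    have : Continuous fun τ => ψ₁ (τ + x) := by fun_prop
    simpa using (this.tendsto 0).mono_left nhdsWithin_le_nhds
  exact le_of_tendsto h2 (eventually_nhdsWithin_of_forall fun τ hτ => (h1 τ hτ).le)

/-- Profiles with the same value at one point coincide. -/
theorem unique (hα0 : 0 < α) (hα1 : α < 1) (hH : IsNormalized H φm φp)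
    (h₁ : IsProfile α H φm φp ψ₁) (h₂ : IsProfile α H φm φp ψ₂) {x₀ : ℝ} (h : ψ₁ x₀ = ψ₂ x₀) :
    ψ₁ = ψ₂ := by
  obtain ⟨A₁, hA₁0, hA₁⟩ := h₁.exists_amplitude hα0 hα1 hH
  obtain ⟨A₂, hA₂0, hA₂⟩ := h₂.exists_amplitude hα0 hα1 hH
  have hA : A₁ = A₂ := by
    rcases lt_trichotomy A₁ A₂ with hlt | heq | hlt
    · exact absurd (lt_of_amplitude_lt hα0 hα1 h₂ h₁ hA₂ hA₁ hlt x₀) (by simp [h])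
    · exact heq
    · exact absurd (lt_of_amplitude_lt hα0 hα1 h₁ h₂ hA₁ hA₂ hlt x₀) (by simp [h])
  subst hA
  exact funext fun x => le_antisymm (le_of_amplitude_eq hα0 hα1 h₁ h₂ hA₁0 hA₁ hA₂ x)
    (le_of_amplitude_eq hα0 hα1 h₂ h₁ hA₁0 hA₂ hA₁ x)

theorem le_left (hα0 : 0 < α) (hα1 : α < 1) (hH : IsNormalized H φm φp)
    (hψ : IsProfile α H φm φp ψ) (x : ℝ) : ψ x ≤ φm :=
  ge_of_tendsto hψ.tendsto_atBot ((eventually_le_atBot x).mono fun _ hy =>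
    (hψ.strictAnti hα0 hα1 hH).antitone hy)

theorem right_le (hα0 : 0 < α) (hα1 : α < 1) (hH : IsNormalized H φm φp)
    (hψ : IsProfile α H φm φp ψ) (x : ℝ) : φp ≤ ψ x :=
  le_of_tendsto hψ.tendsto_atTop ((eventually_ge_atTop x).mono fun _ hy =>
    (hψ.strictAnti hα0 hα1 hH).antitone hy)

theorem exists_left_bound (hα0 : 0 < α) (hα1 : α < 1) (hH : IsNormalized H φm φp)
    (hψ : IsProfile α H φm φp ψ) :
    ∃ C, 0 < C ∧ ∀ x < 0, |ψ x - φm| ≤ C * Real.exp x := by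
  obtain ⟨A, hA0, hA⟩ := hψ.exists_amplitude hα0 hα1 hH
  obtain ⟨a, ha⟩ := eventually_atBot.1 (hA.eventually (eventually_lt_nhds (lt_add_one A)))
  have hb := hH.lt
  -- The first summand serves `x ≤ a`; for `x ≥ a` the second already exceeds the total jump.
  refine ⟨(A + 1) + (φm - φp) * Real.exp (-a), by
    have := mul_pos (sub_pos.2 hb) (Real.exp_pos (-a)); linarith, fun x _ => ?_⟩
  have hle := hψ.le_left hα0 hα1 hH x
  have hge := hψ.right_le hα0 hα1 hH x
  rw [abs_of_nonpos (by linarith), add_mul]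
  have hp1 : 0 < (A + 1) * Real.exp x := by positivity
  have hp2 : 0 < (φm - φp) * Real.exp (-a) * Real.exp x :=
    mul_pos (mul_pos (sub_pos.2 hb) (Real.exp_pos _)) (Real.exp_pos _)
  rcases le_total x a with h | h
  · have h1 := mul_le_mul_of_nonneg_right (ha x h).le (Real.exp_pos x).le
    rw [mul_right_comm, ← Real.exp_add] at h1
    simp only [neg_add_cancel, Real.exp_zero, one_mul] at h1
    linarith
  · have h1 : 1 ≤ Real.exp (-a) * Real.exp x := by
      rw [← Real.exp_add]; exact Real.one_le_exp (by linarith)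
    have h2 : (φm - φp) * 1 ≤ (φm - φp) * (Real.exp (-a) * Real.exp x) :=
      mul_le_mul_of_nonneg_left h1 (by linarith)
    linarith

end IsProfile

/-! ### The right tail -/

/-- Slope `1` at `φm` makes `H` negative just to its left; the chord from `φp` to such a point lies
above `H`. -/
theorem IsNormalized.exists_chord {H : ℝ → ℝ} {φm φp : ℝ} (hH : IsNormalized H φm φp) :
    ∃ m κ, φp < m ∧ 0 < κ ∧ ∀ y, φp ≤ y → y ≤ m → H y ≤ -(κ * (y - φp)) := by
  have hs := hasDerivAt_iff_tendsto_slope.1 (hH.hasDerivAt φm)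
  rw [hH.deriv_left] at hs
  have hsub : Iio φm ⊆ {φm}ᶜ := fun y hy => ne_of_lt hy
  have hs' := (hs.mono_left (nhdsWithin_mono φm hsub)).eventually (eventually_gt_nhds one_pos)
  obtain ⟨m, ⟨hm1, hm2⟩, hm3⟩ := ((hs'.and (Ioo_mem_nhdsLT hH.lt)).and self_mem_nhdsWithin).exists
  have hm3 : m < φm := hm3
  rw [slope_def_field, hH.left_zero, sub_zero] at hm1
  have hm4 : H m < 0 := by
    by_contra h
    exact absurd hm1 (not_lt.2 (div_nonpos_of_nonneg_of_nonpos (not_lt.1 h) (by linarith)))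
  have hd : 0 < m - φp := by linarith [hm2.1]
  refine ⟨m, -H m / (m - φp), hm2.1, div_pos (by linarith) hd, fun y hy1 hy2 => ?_⟩
  have h1 := hH.convex.2 (mem_univ φp) (mem_univ m)
    (show 0 ≤ (m - y) / (m - φp) from div_nonneg (by linarith) hd.le)
    (show 0 ≤ (y - φp) / (m - φp) from div_nonneg (by linarith) hd.le) (by field_simp; ring)
  simp only [smul_eq_mul, hH.right_zero, mul_zero, zero_add] at h1
  have h2 : (m - y) / (m - φp) * φp + (y - φp) / (m - φp) * m = y := by field_simp; ring
  rw [h2] at h1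
  refine h1.trans (le_of_eq ?_)
  field_simp

namespace IsProfile

variable {α : ℝ} {H : ℝ → ℝ} {φm φp : ℝ} {ψ : ℝ → ℝ}

/-- Long memory: all past differences are nonpositive, and those with `s > x` reach back before `0`,
contributing at most `-(ψ 0 - ψ 1) x^(-α) / α`. The tangent to `H` at `φp` bounds the same quantity
below by a multiple of `ψ x - φp`. -/
theorem exists_right_lower_bound (hα0 : 0 < α) (hα1 : α < 1) (hH : IsNormalized H φm φp)
    (hψ : IsProfile α H φm φp ψ) :
    ∃ C, 0 < C ∧ ∀ x, 1 ≤ x → x ^ (-α) ≤ C * |ψ x - φp| := by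
  have hanti := hψ.strictAnti hα0 hα1 hH
  have hc := marchaud_const_pos hα0 hα1
  set c := α / Real.Gamma (1 - α) with hcdef
  have hδ : 0 < ψ 0 - ψ 1 := sub_pos.2 (hanti one_pos)
  set δ := ψ 0 - ψ 1 with hδdef
  refine ⟨(|deriv H φp| + 1) / (c * δ / α), by positivity, fun x hx => ?_⟩
  have hx0 : 0 < x := by linarith
  have hp : 0 ≤ ψ x - φp := sub_nonneg.2 (hψ.right_le hα0 hα1 hH x)
  rw [abs_of_nonneg hp, div_mul_eq_mul_div, le_div_iff₀ (by positivity)]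
  have h1 := convex_tangent_le hH.convex (hH.hasDerivAt φp) (ψ x)
  rw [hH.right_zero, zero_add, ← hψ.equation x, marchaud, ← hcdef] at h1
  have hint := hψ.leftTame.integrableOn hα0 hα1 x
  have h2 : ∫ s in Ioi (0 : ℝ), (ψ x - ψ (x - s)) * s ^ (-1 - α)
      ≤ ∫ s in Ioi x, (ψ x - ψ (x - s)) * s ^ (-1 - α) := by
    rw [← neg_le_neg_iff, ← integral_neg, ← integral_neg]
    refine setIntegral_mono_set hint.neg ?_ (Ioi_subset_Ioi hx0.le).eventuallyLE
    refine (ae_restrict_iff' measurableSet_Ioi).2 (ae_of_all _ fun s hs => ?_)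
    have hs : 0 < s := hs
    have e1 := hanti.antitone (show x - s ≤ x by linarith)
    have e2 := Real.rpow_nonneg hs.le (-1 - α)
    simp only [Pi.zero_apply]
    nlinarith
  have h3 : ∫ s in Ioi x, (ψ x - ψ (x - s)) * s ^ (-1 - α)
      ≤ ∫ s in Ioi x, -δ * s ^ (-1 - α) := by
    refine setIntegral_mono_on (hint.mono_set (Ioi_subset_Ioi hx0.le))
      ((integrableOn_Ioi_rpow_of_lt (by linarith) hx0).const_mul _) measurableSet_Ioi fun s hs => ?_
    have hs : x < s := hs
    have e1 := hanti.antitone (show x - s ≤ 0 by linarith)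
    have e3 := hanti.antitone hx
    have e2 := Real.rpow_nonneg (hx0.trans hs).le (-1 - α)
    exact mul_le_mul_of_nonneg_right (by linarith) e2
  rw [integral_const_mul, integral_Ioi_rpow_of_lt (by linarith) hx0,
    show -1 - α + 1 = -α by ring, neg_div_neg_eq] at h3
  have h4 : deriv H φp * (ψ x - φp) ≤ c * (-δ * (x ^ (-α) / α)) :=
    h1.trans (mul_le_mul_of_nonneg_left (h2.trans h3) hc.le)
  have h5 : -deriv H φp * (ψ x - φp) ≤ (|deriv H φp| + 1) * (ψ x - φp) :=
    mul_le_mul_of_nonneg_right (by linarith [neg_abs_le (deriv H φp)]) hp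
  have h6 : x ^ (-α) * (c * δ / α) = -(c * (-δ * (x ^ (-α) / α))) := by ring
  linarith

theorem one_sub_rpow_neg_le (hα1 : α < 1) (hα0 : 0 < α) {t : ℝ} (ht0 : 0 ≤ t) (ht : t ≤ 1 / 2) :
    (1 - t) ^ (-α) ≤ 1 + 2 * t := by
  have h1 : (1 - t) ^ (-α) ≤ (1 - t) ^ (-1 : ℝ) :=
    Real.rpow_le_rpow_of_exponent_ge (by linarith) (by linarith) (by linarith)
  refine h1.trans ?_
  rw [Real.rpow_neg_one, inv_le_iff_one_le_mul₀ (by linarith)]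
  nlinarith

/-- Comparison with the barrier `P`, equal to the full jump up to `X` and proportional to `y^(-α)`
afterwards. At a positive maximum of `ψ - φp - P` the memory term is at most `κ P`, whereas the
chord bound requires at least `κ (ψ - φp) > κ P`. -/
theorem exists_right_upper_bound (hα0 : 0 < α) (hα1 : α < 1) (hH : IsNormalized H φm φp)
    (hψ : IsProfile α H φm φp ψ) :
    ∃ C, 0 < C ∧ ∀ x, 0 < x → |ψ x - φp| ≤ C * x ^ (-α) := by
  obtain ⟨m, κ, hm, hκ0, hκ⟩ := hH.exists_chord
  have hc := marchaud_const_pos hα0 hα1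
  set c := α / Real.Gamma (1 - α) with hcdef
  have hψc := hψ.contDiff.continuous
  -- `1 / (1 - α)` comes from `s ≤ x / 2`, where `P` is Lipschitz with constant `2 P x / x`; `1 / α`
  -- comes from `s > x / 2`, where the jump `b` bounds the difference.
  set M := c * (2 ^ α * (1 / (1 - α) + 1 / α)) with hM
  have h1α : 0 < 1 - α := by linarith
  have hM0 : 0 < M := by positivity
  have hXlim : Tendsto (fun X : ℝ => M * X ^ (-α)) atTop (𝓝 0) := by
    simpa using (tendsto_rpow_neg_atTop hα0).const_mul M
  obtain ⟨X, ⟨hX0, hXM⟩, hXψ⟩ := (((eventually_gt_atTop (0 : ℝ)).and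
    (hXlim.eventually (eventually_le_nhds hκ0))).and
    (eventually_forall_ge_atTop.2
      (hψ.tendsto_atTop.eventually (eventually_le_nhds hm)))).exists
  set b := φm - φp with hb
  have hb0 : 0 < b := sub_pos.2 hH.lt
  have hp0 : ∀ x, 0 ≤ ψ x - φp := fun x => sub_nonneg.2 (hψ.right_le hα0 hα1 hH x)
  have hpb : ∀ x, ψ x - φp ≤ b := fun x => by
    have := hψ.le_left hα0 hα1 hH x
    linarith
  set P : ℝ → ℝ := fun y => b * X ^ α * (max y X) ^ (-α) with hP
  have hPc : Continuous P := by
    refine continuous_const.mul (Continuous.rpow_const (by fun_prop) fun y => Or.inl ?_)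
    exact (hX0.trans_le (le_max_right _ _)).ne'
  have hXX : X ^ α * X ^ (-α) = 1 := by rw [← Real.rpow_add hX0]; simp
  have hPX : ∀ y ≤ X, P y = b := fun y hy => by
    simp only [hP, max_eq_right hy]
    rw [mul_assoc, hXX, mul_one]
  have hPb : ∀ y, P y ≤ b := fun y => by
    have h1 : (max y X) ^ (-α) ≤ X ^ (-α) :=
      Real.rpow_le_rpow_of_nonpos hX0 (le_max_right _ _) (by linarith)
    calc P y ≤ b * X ^ α * X ^ (-α) := by
          simp only [hP]; gcongr
      _ = b := by rw [mul_assoc, hXX, mul_one]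
  have hmain : ∀ x, ψ x - φp ≤ P x := by
    intro x₁
    by_contra hcon
    have hX1 : X < x₁ := by
      by_contra h
      rw [hPX x₁ (not_lt.1 h)] at hcon
      exact hcon (hpb x₁)
    obtain ⟨x, hx, hmax⟩ := (isCompact_Icc (a := X) (b := x₁)).exists_isMaxOn
      (nonempty_Icc.2 hX1.le) (f := fun y => ψ y - φp - P y) (by fun_prop)
    have hmax' : ∀ y ∈ Icc X x₁, ψ y - φp - P y ≤ ψ x - φp - P x := fun y hy => hmax hy
    have hpos : 0 < ψ x - φp - P x :=
      (sub_pos.2 (not_le.1 hcon)).trans_le (hmax' x₁ ⟨hX1.le, le_rfl⟩)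
    have hXx : X < x := by
      by_contra h
      rw [hPX x (not_lt.1 h)] at hpos
      linarith [hpb x]
    have hx0 : 0 < x := hX0.trans hXx
    have hall : ∀ y ≤ x, ψ y - ψ x ≤ P y - P x := by
      intro y hy
      rcases le_total X y with h | h
      · linarith [hmax' y ⟨h, hy.trans hx.2⟩]
      · rw [hPX y h]; linarith [hpb y]
    have hPx : P x = b * X ^ α * x ^ (-α) := by simp only [hP, max_eq_left hXx.le]
    have hPx0 : 0 < P x := by rw [hPx]; positivity
    have hnear : ∀ s, 0 < s → s ≤ x / 2 → P (x - s) - P x ≤ P x * (2 / x) * s := by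
      intro s hs0 hs
      have e1 : (max (x - s) X) ^ (-α) ≤ (x - s) ^ (-α) :=
        Real.rpow_le_rpow_of_nonpos (by linarith) (le_max_left _ _) (by linarith)
      have e2 : (x - s) ^ (-α) = x ^ (-α) * (1 - s / x) ^ (-α) := by
        rw [← Real.mul_rpow hx0.le (by
          rw [sub_nonneg, div_le_one hx0]; linarith)]
        congr 1
        field_simp
      have e3 := one_sub_rpow_neg_le hα1 hα0 (t := s / x) (by positivity) (by
        rw [div_le_iff₀ hx0]; linarith)
      have e4 : P (x - s) ≤ b * X ^ α * (x ^ (-α) * (1 + 2 * (s / x))) := by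
        simp only [hP]
        gcongr
        rw [e2] at e1
        exact e1.trans (by gcongr)
      have e5 : b * X ^ α * (x ^ (-α) * (1 + 2 * (s / x))) = P x + P x * (2 / x) * s := by
        rw [hPx]; ring
      linarith
    have hint : IntegrableOn (fun s => (ψ (x - s) - ψ x) * s ^ (-1 - α)) (Ioi 0) := by
      refine (hψ.leftTame.integrableOn hα0 hα1 x).neg.congr (ae_of_all _ fun s => ?_)
      simp only [Pi.neg_apply]; ring
    have hx2 : 0 < x / 2 := by positivity
    have hI1 : ∫ s in Ioc 0 (x / 2), (ψ (x - s) - ψ x) * s ^ (-1 - α)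
        ≤ P x * (2 / x) * ((x / 2) ^ (1 - α) / (1 - α)) := by
      have e0 : IntegrableOn (fun s : ℝ => s ^ (-α)) (Ioc 0 (x / 2)) :=
        (intervalIntegral.intervalIntegrable_rpow' (by linarith)).1
      have e1 : ∫ s in Ioc 0 (x / 2), s ^ (-α) = (x / 2) ^ (1 - α) / (1 - α) := by
        rw [← intervalIntegral.integral_of_le hx2.le, integral_rpow (Or.inl (by linarith)),
          show -α + 1 = 1 - α by ring, Real.zero_rpow h1α.ne', sub_zero]
      rw [← e1, ← integral_const_mul]
      refine setIntegral_mono_on (hint.mono_set Ioc_subset_Ioi_self) (e0.const_mul _)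
        measurableSet_Ioc fun s hs => ?_
      have e2 : s ^ (-α) = s * s ^ (-1 - α) := by
        have : s ^ (-α) = s ^ (1 : ℝ) * s ^ (-1 - α) := by
          rw [← Real.rpow_add hs.1]; ring_nf
        rwa [Real.rpow_one] at this
      rw [e2, ← mul_assoc]
      exact mul_le_mul_of_nonneg_right ((hall (x - s) (by linarith [hs.1])).trans
        (hnear s hs.1 hs.2)) (Real.rpow_nonneg hs.1.le _)
    have hI2 : ∫ s in Ioi (x / 2), (ψ (x - s) - ψ x) * s ^ (-1 - α)
        ≤ b * ((x / 2) ^ (-α) / α) := by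
      have e1 : ∫ s in Ioi (x / 2), s ^ (-1 - α) = (x / 2) ^ (-α) / α := by
        rw [integral_Ioi_rpow_of_lt (by linarith) hx2, show -1 - α + 1 = -α by ring,
          neg_div_neg_eq]
      rw [← e1, ← integral_const_mul]
      refine setIntegral_mono_on (hint.mono_set (Ioi_subset_Ioi hx2.le))
        ((integrableOn_Ioi_rpow_of_lt (by linarith) hx2).const_mul _)
        measurableSet_Ioi fun s hs => ?_
      have hs0 : 0 < s := hx2.trans hs
      exact mul_le_mul_of_nonneg_right (by linarith [hpb (x - s), hp0 x])
        (Real.rpow_nonneg hs0.le _)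
    have hI : ∫ s in Ioi (0 : ℝ), (ψ (x - s) - ψ x) * s ^ (-1 - α)
        ≤ P x * (2 ^ α * (1 / (1 - α) + 1 / α)) * X ^ (-α) := by
      rw [← Ioc_union_Ioi_eq_Ioi hx2.le, setIntegral_union (Ioc_disjoint_Ioi le_rfl)
        measurableSet_Ioi (hint.mono_set Ioc_subset_Ioi_self)
        (hint.mono_set (Ioi_subset_Ioi hx2.le))]
      have e1 : (x / 2) ^ (-α) = 2 ^ α * x ^ (-α) := by
        rw [Real.div_rpow hx0.le (by norm_num), Real.rpow_neg (by norm_num : (0 : ℝ) ≤ 2),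
          div_inv_eq_mul, mul_comm]
      have e2 : (2 / x) * (x / 2) ^ (1 - α) = 2 ^ α * x ^ (-α) := by
        rw [← e1, sub_eq_add_neg, Real.rpow_add hx2, Real.rpow_one]
        field_simp
      -- The far memory `b x^(-α)` is a small multiple of `P x` when `X` is large.
      have e3 : b * x ^ (-α) = P x * X ^ (-α) := by
        rw [hPx]; linear_combination (-b * x ^ (-α)) * hXX
      have e4 : x ^ (-α) ≤ X ^ (-α) :=
        Real.rpow_le_rpow_of_nonpos hX0 hXx.le (by linarith)
      have e5 : P x * (2 / x) * ((x / 2) ^ (1 - α) / (1 - α))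
          = P x * 2 ^ α * (1 / (1 - α)) * x ^ (-α) := by
        linear_combination (P x / (1 - α)) * e2
      have e6 : b * ((x / 2) ^ (-α) / α) = P x * 2 ^ α * (1 / α) * X ^ (-α) := by
        rw [e1]; linear_combination (2 ^ α / α) * e3
      have e7 : P x * 2 ^ α * (1 / (1 - α)) * x ^ (-α)
          ≤ P x * 2 ^ α * (1 / (1 - α)) * X ^ (-α) := by gcongr
      linarith
    have hchord := hκ (ψ x) (by linarith [hp0 x]) (hXψ x hXx.le)
    have hneg : marchaud α ψ x
        = -(c * ∫ s in Ioi (0 : ℝ), (ψ (x - s) - ψ x) * s ^ (-1 - α)) := by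
      rw [marchaud, ← hcdef, ← mul_neg, ← integral_neg]
      congr 2; ext s; ring
    rw [← hψ.equation x, hneg] at hchord
    have hfin : c * ∫ s in Ioi (0 : ℝ), (ψ (x - s) - ψ x) * s ^ (-1 - α) ≤ κ * P x := by
      calc _ ≤ c * (P x * (2 ^ α * (1 / (1 - α) + 1 / α)) * X ^ (-α)) := by gcongr
        _ = M * X ^ (-α) * P x := by rw [hM]; ring
        _ ≤ κ * P x := by gcongr
    have := mul_pos hκ0 hpos
    linarith
  refine ⟨b * X ^ α, by positivity, fun x hx => ?_⟩
  rw [abs_of_nonneg (hp0 x)]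
  refine (hmain x).trans ?_
  exact mul_le_mul_of_nonneg_left
    (Real.rpow_le_rpow_of_nonpos hx (le_max_left _ _) (by linarith)) (by positivity)

end IsProfile

/-! ### Travelling waves -/

section Nonlinearity

variable {f : ℝ → ℝ} {φm φp : ℝ}

theorem contDiff_h (hf : ContDiff ℝ ∞ f) : ContDiff ℝ ∞ (h f φm φp) := by
  unfold h
  fun_prop

theorem convexOn_h (hconv : ConvexOn ℝ univ f) : ConvexOn ℝ univ (h f φm φp) := by
  refine ⟨convex_univ, fun x _ y _ a b ha hb hab => ?_⟩
  have h1 := hconv.2 (mem_univ x) (mem_univ y) ha hb hab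
  simp only [smul_eq_mul, h] at h1 ⊢
  obtain rfl : b = 1 - a := by linarith
  linarith

theorem h_left : h f φm φp φm = 0 := by simp [h]

theorem h_right (hφ : φp < φm) : h f φm φp φp = 0 := by
  have : φp - φm ≠ 0 := by linarith
  simp only [h, speed]
  field_simp
  ring

theorem isNormalized_h (hf : ContDiff ℝ ∞ f) (hconv : ConvexOn ℝ univ f) (hφ : φp < φm)
    (hpos : 0 < deriv (h f φm φp) φm) :
    IsNormalized (fun y => (deriv (h f φm φp) φm)⁻¹ * h f φm φp y) φm φp where
  contDiff := contDiff_const.mul (by exact_mod_cast contDiff_infty.1 (contDiff_h hf) 2)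
  convex := by
    simpa only [smul_eq_mul] using (convexOn_h hconv).smul (inv_pos.2 hpos).le
  lt := hφ
  left_zero := by rw [h_left, mul_zero]
  right_zero := by rw [h_right hφ, mul_zero]
  deriv_left := by
    rw [deriv_const_mul _ ((contDiff_h hf).differentiable (by simp) φm),
      inv_mul_cancel₀ hpos.ne']

end Nonlinearity

namespace IsTravellingWave

variable {α : ℝ} {f : ℝ → ℝ} {φm φp ε : ℝ} {φ : ℝ → ℝ}

theorem leftTame (hw : IsTravellingWave α f φm φp ε φ) : LeftTame φ :=
  let ⟨_, hB⟩ := exists_bound_of_tendsto hw.contDiff.continuous hw.tendsto_atBot hw.tendsto_atTop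
  LeftTame.of_bounded hw.contDiff hB

theorem eq_marchaud (hα0 : 0 < α) (hα1 : α < 1) (hw : IsTravellingWave α f φm φp ε φ) (ξ : ℝ) :
    h f φm φp (φ ξ) = ε * marchaud α φ ξ := by
  obtain ⟨D, hD, hD'⟩ := hw.equation ξ
  rw [hD', tendsto_nhds_unique hD (hw.leftTame.hasFracDeriv hα0 hα1 ξ)]

/-- Otherwise the chord condition forces slope `0` and convexity gives `h ≥ 0`, so `𝒟^α φ ≥ 0`; but
at a positive past maximum of `φm - φ` the maximum principle gives `𝒟^α φ < 0`. -/
theorem deriv_h_pos (hα0 : 0 < α) (hα1 : α < 1) (hf : ContDiff ℝ ∞ f)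
    (hconv : ConvexOn ℝ univ f) (hφ : φp < φm) (hε : 0 < ε)
    (hw : IsTravellingWave α f φm φp ε φ) : 0 < deriv (h f φm φp) φm := by
  by_contra hcon
  have hd : HasDerivAt (h f φm φp) (deriv (h f φm φp) φm) φm :=
    ((contDiff_h hf).differentiable (by simp) φm).hasDerivAt
  have htan := convex_tangent_le (convexOn_h hconv) hd
  rw [h_left] at htan
  have h0 : deriv (h f φm φp) φm = 0 := by
    have h1 := htan φp
    rw [h_right hφ] at h1
    refine le_antisymm (not_lt.1 hcon) ?_
    by_contra h2
    nlinarith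
  have hnn : ∀ y, 0 ≤ h f φm φp y := fun y => by
    have := htan y
    rw [h0] at this
    linarith
  have htame := (LeftTame.const φm).sub hw.leftTame
  have hlim : Tendsto (fun x => φm - φ x) atBot (𝓝 0) := by
    simpa using hw.tendsto_atBot.const_sub φm
  obtain ⟨x, hx⟩ := ((hw.tendsto_atTop.const_sub φm).eventually
    (eventually_gt_nhds (sub_pos.2 hφ))).exists
  obtain ⟨x', hx', hge, hmax⟩ := exists_max_past htame.continuous hlim hx
  obtain ⟨y, hy, hlt⟩ := exists_lt_past hlim (hx.trans_le hge)
  have hpos := marchaud_pos_of_max hα0 hα1 htame (fun y hy => hmax y (hy.trans hx')) hy hlt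
  rw [(LeftTame.const φm).marchaud_sub hw.leftTame hα0 hα1, marchaud_const] at hpos
  have h1 := hnn (φ x')
  rw [hw.eq_marchaud hα0 hα1] at h1
  have := nonneg_of_mul_nonneg_right h1 hε
  linarith

theorem rate_pos (hε : 0 < ε) (hpos : 0 < deriv (h f φm φp) φm) : 0 < rate α f φm φp ε :=
  Real.rpow_pos_of_pos (div_pos hpos hε) _

theorem rate_rpow (hα0 : 0 < α) (hε : 0 < ε) (hpos : 0 < deriv (h f φm φp) φm) :
    rate α f φm φp ε ^ α = deriv (h f φm φp) φm / ε := by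
  rw [rate, ← Real.rpow_mul (div_pos hpos hε).le, one_div_mul_cancel hα0.ne', Real.rpow_one]

/-- The rate satisfies `rate ^ α = h'(φ₋) / ε`, so this rescaling removes `ε`: waves for all `ε`
solve one and the same profile equation. -/
theorem isProfile (hα0 : 0 < α) (hα1 : α < 1) (hε : 0 < ε) (hpos : 0 < deriv (h f φm φp) φm)
    (hw : IsTravellingWave α f φm φp ε φ) (ξ₀ : ℝ) :
    IsProfile α (fun y => (deriv (h f φm φp) φm)⁻¹ * h f φm φp y) φm φp
      (fun x => φ (ξ₀ + (rate α f φm φp ε)⁻¹ * x)) := by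
  have hrate := rate_pos (α := α) hε hpos
  have hri : 0 < (rate α f φm φp ε)⁻¹ := inv_pos.2 hrate
  have hcd := hw.contDiff
  refine ⟨by fun_prop, fun x => ?_, ?_, ?_⟩
  · rw [marchaud_comp_affine α φ hri, Real.inv_rpow hrate.le, rate_rpow hα0 hε hpos,
      hw.eq_marchaud hα0 hα1]
    field_simp
  · exact hw.tendsto_atBot.comp (tendsto_atBot_add_const_left _ ξ₀
      (tendsto_id.const_mul_atBot hri))
  · exact hw.tendsto_atTop.comp (tendsto_atTop_add_const_left _ ξ₀
      (tendsto_id.const_mul_atTop hri))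

theorem rescale_cancel (hε : 0 < ε) (hpos : 0 < deriv (h f φm φp) φm) (ξ₀ ξ : ℝ) :
    ξ₀ + (rate α f φm φp ε)⁻¹ * (rate α f φm φp ε * (ξ - ξ₀)) = ξ := by
  rw [inv_mul_cancel_left₀ (rate_pos hε hpos).ne']
  ring

theorem rate_mul_rpow_neg (hα0 : 0 < α) (hε : 0 < ε) (hpos : 0 < deriv (h f φm φp) φm) {t : ℝ}
    (ht : 0 < t) :
    (rate α f φm φp ε * t) ^ (-α) = (deriv (h f φm φp) φm)⁻¹ * (ε / t ^ α) := by
  have hrate := rate_pos (α := α) hε hpos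
  rw [Real.rpow_neg (by positivity), Real.mul_rpow hrate.le ht.le, rate_rpow hα0 hε hpos]
  field_simp

theorem isBigO_left (hα0 : 0 < α) (hα1 : α < 1) (hf : ContDiff ℝ ∞ f)
    (hconv : ConvexOn ℝ univ f) (hφ : φp < φm) (hε : 0 < ε)
    (hw : IsTravellingWave α f φm φp ε φ) :
    (fun ξ : ℝ => |φ ξ - φm|) =O[atBot] (fun ξ : ℝ => Real.exp (rate α f φm φp ε * ξ)) := by
  have hpos := hw.deriv_h_pos hα0 hα1 hf hconv hφ hε
  have hrate := rate_pos (α := α) hε hpos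
  obtain ⟨C, hC0, hC⟩ := (hw.isProfile hα0 hα1 hε hpos 0).exists_left_bound hα0 hα1
    (isNormalized_h hf hconv hφ hpos)
  refine IsBigO.of_bound C ?_
  filter_upwards [eventually_lt_atBot 0] with ξ hξ
  have h1 := hC (rate α f φm φp ε * (ξ - 0)) (by
    rw [sub_zero]; exact mul_neg_of_pos_of_neg hrate hξ)
  rw [rescale_cancel hε hpos 0 ξ, sub_zero] at h1
  rwa [Real.norm_eq_abs, abs_abs, Real.norm_eq_abs, abs_of_pos (Real.exp_pos _)]

theorem isBigO_right (hα0 : 0 < α) (hα1 : α < 1) (hf : ContDiff ℝ ∞ f)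
    (hconv : ConvexOn ℝ univ f) (hφ : φp < φm) (hε : 0 < ε)
    (hw : IsTravellingWave α f φm φp ε φ) :
    (fun ξ : ℝ => |φ ξ - φp|) =O[atTop] (fun ξ : ℝ => ε / ξ ^ α) ∧
      (fun ξ : ℝ => ε / ξ ^ α) =O[atTop] (fun ξ : ℝ => |φ ξ - φp|) := by
  have hpos := hw.deriv_h_pos hα0 hα1 hf hconv hφ hε
  have hrate := rate_pos (α := α) hε hpos
  have hN := isNormalized_h hf hconv hφ hpos
  have hP := hw.isProfile hα0 hα1 hε hpos 0
  obtain ⟨C, hC0, hC⟩ := hP.exists_right_upper_bound hα0 hα1 hN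
  obtain ⟨c, hc0, hc⟩ := hP.exists_right_lower_bound hα0 hα1 hN
  constructor
  · refine IsBigO.of_bound (C * (deriv (h f φm φp) φm)⁻¹) ?_
    filter_upwards [eventually_gt_atTop 0] with ξ hξ
    have h1 := hC (rate α f φm φp ε * (ξ - 0)) (by rw [sub_zero]; positivity)
    rw [rescale_cancel hε hpos 0 ξ, sub_zero, rate_mul_rpow_neg hα0 hε hpos hξ,
      ← mul_assoc] at h1
    rwa [Real.norm_eq_abs, abs_abs, Real.norm_of_nonneg (by positivity)]
  · refine IsBigO.of_bound (deriv (h f φm φp) φm * c) ?_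
    filter_upwards [eventually_gt_atTop 0, eventually_ge_atTop (rate α f φm φp ε)⁻¹] with ξ hξ hξ'
    have h1 := hc (rate α f φm φp ε * (ξ - 0)) (by
      rw [sub_zero]
      calc 1 = rate α f φm φp ε * (rate α f φm φp ε)⁻¹ := (mul_inv_cancel₀ hrate.ne').symm
        _ ≤ _ := by gcongr)
    rw [rescale_cancel hε hpos 0 ξ, sub_zero, rate_mul_rpow_neg hα0 hε hpos hξ] at h1
    rw [Real.norm_eq_abs, Real.norm_eq_abs, abs_abs, abs_of_nonneg (by positivity), mul_assoc]
    rwa [inv_mul_le_iff₀ hpos] at h1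

end IsTravellingWave

/-- Bounds that are uniform in `ε` for waves with a fixed phase. -/
theorem exists_uniform_bound {α : ℝ} (hα0 : 0 < α) (hα1 : α < 1) {f : ℝ → ℝ}
    (hf : ContDiff ℝ ∞ f) (hconv : ConvexOn ℝ univ f) {φm φp : ℝ} (hφ : φp < φm) (m : ℝ) :
    ∃ C : ℝ, 0 < C ∧ ∀ ε : ℝ, 0 < ε → ∀ φ : ℝ → ℝ, IsTravellingWave α f φm φp ε φ →
      ∀ ξ₀ : ℝ, φ ξ₀ = m →
        (∀ ξ : ℝ, ξ < ξ₀ → |φ ξ - φm| ≤ C * Real.exp (rate α f φm φp ε * (ξ - ξ₀))) ∧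
        (∀ ξ : ℝ, ξ₀ < ξ → |φ ξ - φp| ≤ C * (ε / (ξ - ξ₀) ^ α)) := by
  -- The constant is read off a single profile through `m` at `0`; by uniqueness every wave is a
  -- rescaling of it. If there is none, there are no waves to bound.
  by_cases hex : ∃ ψ, 0 < deriv (h f φm φp) φm ∧ ψ 0 = m ∧
      IsProfile α (fun y => (deriv (h f φm φp) φm)⁻¹ * h f φm φp y) φm φp ψ
  · obtain ⟨ψ, hpos, hψm, hψ⟩ := hex
    have hN := isNormalized_h hf hconv hφ hpos
    obtain ⟨C₁, hC₁0, hC₁⟩ := hψ.exists_left_bound hα0 hα1 hN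
    obtain ⟨C₂, hC₂0, hC₂⟩ := hψ.exists_right_upper_bound hα0 hα1 hN
    refine ⟨max C₁ (C₂ * (deriv (h f φm φp) φm)⁻¹), lt_max_of_lt_left hC₁0,
      fun ε hε φ hw ξ₀ hξ₀ => ?_⟩
    have hrate := IsTravellingWave.rate_pos (α := α) hε hpos
    have huniq := (hw.isProfile hα0 hα1 hε hpos ξ₀).unique hα0 hα1 hN hψ (x₀ := 0)
      (by simp [hξ₀, hψm])
    have happ : ∀ ξ, φ ξ = ψ (rate α f φm φp ε * (ξ - ξ₀)) := fun ξ => by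
      rw [← huniq]
      simp only [IsTravellingWave.rescale_cancel hε hpos]
    constructor
    · intro ξ hξ
      rw [happ ξ]
      refine (hC₁ _ (mul_neg_of_pos_of_neg hrate (by linarith))).trans ?_
      gcongr
      exact le_max_left _ _
    · intro ξ hξ
      have hd : 0 < ξ - ξ₀ := by linarith
      rw [happ ξ]
      refine (hC₂ _ (by positivity)).trans ?_
      rw [IsTravellingWave.rate_mul_rpow_neg hα0 hε hpos hd, ← mul_assoc]
      gcongr
      exact le_max_right _ _
  · refine ⟨1, one_pos, fun ε hε φ hw ξ₀ hξ₀ => absurd ?_ hex⟩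
    have hpos := hw.deriv_h_pos hα0 hα1 hf hconv hφ hε
    exact ⟨_, hpos, by simp [hξ₀], hw.isProfile hα0 hα1 hε hpos ξ₀⟩

theorem tendsto_rate {α : ℝ} (hα0 : 0 < α) {f : ℝ → ℝ} {φm φp : ℝ}
    (hpos : 0 < deriv (h f φm φp) φm) : Tendsto (rate α f φm φp) (𝓝[>] 0) atTop := by
  have h1 : Tendsto (fun ε : ℝ => deriv (h f φm φp) φm / ε) (𝓝[>] 0) atTop := by
    simpa only [div_eq_mul_inv] using tendsto_inv_nhdsGT_zero.const_mul_atTop hpos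
  exact (tendsto_rpow_atTop (one_div_pos.2 hα0)).comp h1

/-- Convergence to the shock profile in the limit of vanishing `ε`. -/
theorem tendsto_shock {α : ℝ} (hα0 : 0 < α) (hα1 : α < 1) {f : ℝ → ℝ}
    (hf : ContDiff ℝ ∞ f) (hconv : ConvexOn ℝ univ f) {φm φp : ℝ} (hφ : φp < φm)
    {Φ : ℝ → ℝ → ℝ} (hΦ : ∀ ε : ℝ, 0 < ε → IsTravellingWave α f φm φp ε (Φ ε)) {m : ℝ}
    {s : ℝ → ℝ} {ξ₀ : ℝ} (hs : ∀ ε : ℝ, 0 < ε → Φ ε (s ε) = m)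
    (hlim : Tendsto s (𝓝[>] 0) (𝓝 ξ₀)) {ξ : ℝ} (hξ : ξ ≠ ξ₀) :
    Tendsto (fun ε : ℝ => Φ ε ξ) (𝓝[>] 0) (𝓝 (shock φm φp ξ₀ ξ)) := by
  obtain ⟨C, hC0, hC⟩ := exists_uniform_bound hα0 hα1 hf hconv hφ m
  -- The sign of `h'(φ₋)` does not involve `ε`, so the wave with `ε = 1` suffices.
  have hpos := (hΦ 1 one_pos).deriv_h_pos hα0 hα1 hf hconv hφ one_pos
  have hdiff : Tendsto (fun ε => ξ - s ε) (𝓝[>] 0) (𝓝 (ξ - ξ₀)) := hlim.const_sub ξ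
  rw [tendsto_iff_norm_sub_tendsto_zero]
  rcases lt_or_gt_of_ne hξ with hlt | hgt
  · rw [shock, if_pos hlt]
    have h1 : Tendsto (fun ε => rate α f φm φp ε * (ξ - s ε)) (𝓝[>] 0) atBot :=
      (tendsto_rate hα0 hpos).atTop_mul_neg (sub_neg.2 hlt) hdiff
    have h2 : Tendsto (fun ε => C * Real.exp (rate α f φm φp ε * (ξ - s ε))) (𝓝[>] 0) (𝓝 0) := by
      simpa using (Real.tendsto_exp_atBot.comp h1).const_mul C
    refine squeeze_zero' (Eventually.of_forall fun _ => norm_nonneg _) ?_ h2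
    filter_upwards [self_mem_nhdsWithin, hlim.eventually (lt_mem_nhds hlt)] with ε hε hε'
    exact (hC ε hε _ (hΦ ε hε) _ (hs ε hε)).1 ξ hε'
  · rw [shock, if_neg (not_lt.2 hgt.le)]
    have h1 : Tendsto (fun ε : ℝ => C * (ε / (ξ - s ε) ^ α)) (𝓝[>] 0) (𝓝 0) := by
      have e1 : Tendsto (fun ε => (ξ - s ε) ^ α) (𝓝[>] 0) (𝓝 ((ξ - ξ₀) ^ α)) :=
        hdiff.rpow_const (Or.inr hα0.le)
      have e2 : Tendsto (fun ε : ℝ => ε) (𝓝[>] 0) (𝓝 0) := tendsto_id.mono_left nhdsWithin_le_nhds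
      have e3 := (e2.div e1 (Real.rpow_pos_of_pos (sub_pos.2 hgt) α).ne').const_mul C
      simpa using e3
    refine squeeze_zero' (Eventually.of_forall fun _ => norm_nonneg _) ?_ h1
    filter_upwards [self_mem_nhdsWithin, hlim.eventually (gt_mem_nhds hgt)] with ε hε hε'
    exact (hC ε hε _ (hΦ ε hε) _ (hs ε hε)).2 ξ hε'

end FracTW

theorem mainTheorem3 (α : ℝ) (hα0 : 0 < α) (hα1 : α < 1)
    (f : ℝ → ℝ) (hf : ContDiff ℝ ∞ f) (hconv : ConvexOn ℝ Set.univ f)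
    (φm φp : ℝ) (hφ : φp < φm) :
    -- tail behaviour of every solution, for every fixed `ε`
    (∀ ε : ℝ, 0 < ε → ∀ φ : ℝ → ℝ, FracTW.IsTravellingWave α f φm φp ε φ →
      0 < deriv (FracTW.h f φm φp) φm ∧
      0 < FracTW.rate α f φm φp ε ∧
      (fun ξ : ℝ => |φ ξ - φm|) =O[atBot]
        (fun ξ : ℝ => Real.exp (FracTW.rate α f φm φp ε * ξ)) ∧
      (fun ξ : ℝ => |φ ξ - φp|) =O[atTop] (fun ξ : ℝ => ε / ξ ^ α) ∧
      (fun ξ : ℝ => ε / ξ ^ α) =O[atTop] (fun ξ : ℝ => |φ ξ - φp|)) ∧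
    -- the same bounds with a constant independent of `ε`, for solutions with a fixed phase
    (∀ m : ℝ, φp < m → m < φm → ∃ C : ℝ, 0 < C ∧
      ∀ ε : ℝ, 0 < ε → ∀ φ : ℝ → ℝ, FracTW.IsTravellingWave α f φm φp ε φ →
        ∀ ξ₀ : ℝ, φ ξ₀ = m →
          (∀ ξ : ℝ, ξ < ξ₀ →
            |φ ξ - φm| ≤ C * Real.exp (FracTW.rate α f φm φp ε * (ξ - ξ₀))) ∧
          (∀ ξ : ℝ, ξ₀ < ξ → |φ ξ - φp| ≤ C * (ε / (ξ - ξ₀) ^ α))) ∧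
    -- pointwise convergence to a shock as `ε → 0⁺`
    (∀ Φ : ℝ → ℝ → ℝ, (∀ ε : ℝ, 0 < ε → FracTW.IsTravellingWave α f φm φp ε (Φ ε)) →
      ∀ m : ℝ, φp < m → m < φm →
        ∀ (s : ℝ → ℝ) (ξ₀ : ℝ), (∀ ε : ℝ, 0 < ε → Φ ε (s ε) = m) →
          Tendsto s (𝓝[>] 0) (𝓝 ξ₀) →
            ∀ ξ : ℝ, ξ ≠ ξ₀ →
              Tendsto (fun ε : ℝ => Φ ε ξ) (𝓝[>] 0) (𝓝 (FracTW.shock φm φp ξ₀ ξ))) := by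
  refine ⟨fun ε hε φ hw => ?_, fun m _ _ => ?_, fun Φ hΦ m _ _ s ξ₀ hs hlim ξ hξ => ?_⟩
  · have hpos := hw.deriv_h_pos hα0 hα1 hf hconv hφ hε
    exact ⟨hpos, FracTW.IsTravellingWave.rate_pos hε hpos,
      hw.isBigO_left hα0 hα1 hf hconv hφ hε, hw.isBigO_right hα0 hα1 hf hconv hφ hε⟩
  · exact FracTW.exists_uniform_bound hα0 hα1 hf hconv hφ m
  · exact FracTW.tendsto_shock hα0 hα1 hf hconv hφ hΦ hs hlim hξ
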